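/- **Setting.** Let $D=D_0\cup\dots\cup D_{m-1}$ ($m\ge 1$) be the anticanonical cycle of rational curves of a log Calabi--Yau surface pair $(Y,D)$ with maximal boundary, $U=Y\setminus D$, where $D_i$ joins node $i$ to node $i+1$ (indices modulo $m$). Let $k_i$ be the degree of the normal bundle of $D_i$ (of the normalization of $D$ if $m=1$), and let $\sum_i a_iD_i$, $a_i>0$, be an ample divisor supported on $D$, so that $a_{i-1}+k_ia_i+a_{i+1}>0$ for all $i$. Only the numbers $(m,k_i,a_i)$ enter below, and the statement holds for all such numbers. *The integral points of $U^{\mathrm{trop}}$.* Near node $i$ choose coordinates $(z_i,w_i)$ with $D_i=\{z_i=0\}$, $D_{i-1}=\{w_i=0\}$; the clockwise loops $\Gamma_{z_i},\Gamma_{w_i}$ in the two coordinates form a basis of $H_1(T^2;\mathbb Z)$ of the nearby tori. Along $D_i$ the bases at nodes $i$ and $i+1$ are identified by $\Gamma_{z_i}=\Gamma_{w_{i+1}}$, $-\Gamma_{w_i}=\Gamma_{z_{i+1}}+k_i\Gamma_{z_i}$. Let $Q_i=\{a\Gamma_{z_i}+b\Gamma_{w_i}: a,b\in\mathbb Z_{\ge0}\}$,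 and let $U^{\mathrm{trop}}(\mathbb Z)$ be the union of the $Q_i$, glued along their edges by $n\Gamma_{z_i}=n\Gamma_{w_{i+1}}$; $0$ is the common apex. *The contact boundary.* A neighbourhood of $D$ is locally toric, with moment map $(\tfrac12|z_j|^2,\tfrac12|w_j|^2)=(\xi_j,\xi_{j-1})$ at node $j$. Develop it over the universal cover $\mathbb R$ of $S=\mathbb R/m\mathbb Z$, with $j\in\mathbb Z$, where $s=j$ is the node $j$ and $[j,j+1]$ is the part along $D_j$. The hypersurface $\Sigma$ is the union of the torus fibres over a smooth closed path $s\mapsto(\xi_j(s))_j$, with $\xi_{j-1}+k_j\xi_j+\xi_{j+1}=a_{j-1}+k_ja_j+a_{j+1}$ and $\xi_{j+m}(s+m)=\xi_j(s)$, which runs near $D$: $0<\xi_j<a_j$, $\xi_{j-1}>0$ and $\xi_{j+1}>0$ on $[j,j+1]$. So $\pi:\Sigma\to S$ is a torus bundle glued by the above identifications of $H_1$. Let $\lambda$ be the torus-invariant Liouville form that at node $j$ equals $(\xi_j-a_j)\,d\arg z_j+(\xi_{j-1}-a_{j-1})\,d\arg w_j$, and let $$\alpha=e^{u(s)}\lambda|_\Sigma+h(s)\,ds,$$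 with $u,h$ smooth and $m$-periodic. Assume that $\alpha$ is a contact form, positive for the orientation of $\Sigma$ as the boundary of the side away from $D$, and that the Liouville class $A(s)=[\alpha|_{\pi^{-1}(s)}]\in H^1(\pi^{-1}(s);\mathbb R)$ (a path in a fixed plane, by parallel transport) is locally convex with respect to the origin: $\dfrac{A'\wedge A''}{A\wedge A'}>0$. Let $A'(s)^\perp\subset H_1(\pi^{-1}(s);\mathbb R)$ be the annihilator of $A'(s)$, i.e. the line of directions of the Reeb field on $\pi^{-1}(s)$. *The Hamiltonian.* On the cylinder $\Sigma\times\mathbb R$ with Liouville form $e^\rho\alpha$ and $\omega=d(e^\rho\alpha)$, let $H=(e^\rho)^2/2$ and let $X_H$ be given by $\omega(\cdot,X_H)=dH$. **Theorem.** There are points $t_j\in\mathbb R$ ($j\in\mathbb Z$) with $t_{j-1}<t_j$ and $t_{j+m}=t_j+m$ such that: 1. The line $A'(t_j)^\perp$ is spanned by the normal circle $\Gamma_{z_j}$ of $D_j$, and $\int_{\Gamma_{z_j}}A(s)>0$ for all $s$ between $j$ and $t_j$. If $A'(j)^\perp$ meets the interior of the cone spanned by $Q_j$, then $t_{j-1}<j<t_j$.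 2. As $s$ runs through the neighbourhood $[t_{j-1},t_j]$ of node $j$, the line $A'(s)^\perp$ passes through each rational direction of $Q_j$ exactly once: for each nonzero $v\in Q_j$ there is exactly one $s=s(v)$ in $[t_{j-1},t_j]$ with $v\in A'(s)^\perp$, and $\ell_v:=\int_vA(s(v))>0$. 3. The periods of the closed Reeb orbits of $\alpha$ are bounded below by a positive number. Let $\rho_0\in\mathbb R$ be such that all of them are $\ge e^{\rho_0}$ (for example $\rho_0=0$, if all periods are $\ge1$). Then the space of time-one periodic orbits of $X_H$ in the cylindrical end $\Sigma\times[\rho_0,\infty)$, with the compact-open topology of the loop space, is homeomorphic to a disjoint union $\bigsqcup_p T_p$ of two-dimensional tori indexed by the nonzero points $p\in U^{\mathrm{trop}}(\mathbb Z)$. If $p$ is represented by $v\in Q_j$, then $T_p$ is the set of all linear loops with homology class $v$ in the torus $\pi^{-1}(s(v))\times\{\log\ell_v\}$. -/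

import Mathlib

open scoped ContDiff

namespace LogCY

noncomputable section

/-- The data of the boundary divisor of a polarised log Calabi-Yau pair with maximal boundary that
determine a neighbourhood of it: `D = D_0 + ... + D_{m-1}` is a cycle of `m ≥ 1` rational curves
(`m = 1`: an irreducible nodal curve), `k i` is the degree of the normal bundle of `D_i`
(of the normalisation of `D` if `m = 1`), and `∑ a i • D_i` is the strictly positive ample divisor
supported on `D`; its degree on `D_i` is `a (i - 1) + k i * a i + a (i + 1)`.
The curve `D_i` joins node `i` to node `i + 1`. -/
structure PolarizedCycle (m : ℕ) where
  k : ZMod m → ℤ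
  a : ZMod m → ℝ
  a_pos : ∀ i, 0 < a i
  degree_pos : ∀ i, 0 < a (i - 1) + k i * a i + a (i + 1)

/-- Near node `i`, with coordinates `(z_i, w_i)` such that `D_i = {z_i = 0}` and
`D_{i-1} = {w_i = 0}`, the group `H_1` of the torus fibre has the basis `Γ_{z_i}`, `Γ_{w_i}` of
clockwise loops; `(a, b)` stands for `a Γ_{z_i} + b Γ_{w_i}`. Along a curve `D_i` with normal degree
`n`, this basis is related to the one at the next node by `Γ_{z_i} = Γ_{w_{i+1}}` and
`-Γ_{w_i} = Γ_{z_{i+1}} + n Γ_{z_i}`, that is, by the matrix with rows `(0, -1)` and `(1, -n)`. -/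
def glue (n : ℤ) (v : ℝ × ℝ) : ℝ × ℝ := (-v.2, v.1 - n * v.2)

/-- The exterior derivative of a one-form `β`, evaluated on the vectors `v`, `w`. -/
def dForm {E : Type*} [NormedAddCommGroup E] [NormedSpace ℝ E] (β : E → E →L[ℝ] ℝ) (x v w : E) : ℝ :=
  extDeriv (fun y => ContinuousAlternatingMap.ofSubsingleton ℝ E ℝ (0 : Fin 1) (β y)) x ![v, w]

/-- The three-form `β ∧ dβ`, evaluated on three vectors. -/
def wedgeSelf {E : Type*} [NormedAddCommGroup E] [NormedSpace ℝ E] (β : E → E →L[ℝ] ℝ)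
    (x v₁ v₂ v₃ : E) : ℝ :=
  β x v₁ * dForm β x v₂ v₃ - β x v₂ * dForm β x v₁ v₃ + β x v₃ * dForm β x v₁ v₂

/-- The wedge (cup) product of two elements of the dual of the oriented plane `ℝ × ℝ`. -/
def wedge (A B : ℝ × ℝ →L[ℝ] ℝ) : ℝ := A (1, 0) * B (0, 1) - A (0, 1) * B (1, 0)

namespace PolarizedCycle

variable {m : ℕ} (C : PolarizedCycle m)

/-- Two integral vectors of the cones `Q_i` are identified when they lie on the common edge of
`Q_i` and `Q_{i+1}`: `n Γ_{z_i} = n Γ_{w_{i+1}}`. -/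
inductive EdgeRel (C : PolarizedCycle m) : ZMod m × ℕ × ℕ → ZMod m × ℕ × ℕ → Prop
  | edge (i : ZMod m) (n : ℕ) : EdgeRel C (i, n, 0) (i + 1, 0, n)

/-- The set of integral points of `U^trop`: the union of the integral cones
`Q_i = {a Γ_{z_i} + b Γ_{w_i} | a, b ∈ ℤ_{≥ 0}}`, glued along their edges. -/
def Trop : Type := Quot C.EdgeRel

/-- The point `a Γ_{z_i} + b Γ_{w_i}` of `Q_i`, as an integral point of `U^trop`. -/
def tropPt (i : ZMod m) (a b : ℕ) : C.Trop := Quot.mk _ (i, a, b)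

/-- The singular point of `U^trop`, the common apex of all the cones. -/
def tropZero : C.Trop := C.tropPt 0 0 0

/-- The torus bundle `Σ → S = ℝ / mℤ` around `D` is described by charts centred at the nodes. In
the chart of the node `j` (an integer, counted modulo `m`), developed along the universal cover `ℝ`
of the base `S` in which the node `j` sits at `s = j`, a point is `(q, s)` with `q ∈ H_1 ⊗ ℝ = ℝ × ℝ`;
it lies in the fibre `(H_1 ⊗ ℝ) / H_1`, and its angles are `arg z = -2π q.1`, `arg w = -2π q.2`.
These are all the identifications between points of the charts. -/
inductive BdryRel (C : PolarizedCycle m) : ℤ × (ℝ × ℝ) × ℝ → ℤ × (ℝ × ℝ) × ℝ → Prop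
  | lattice (j : ℤ) (q : ℝ × ℝ) (s : ℝ) (n₁ n₂ : ℤ) :
      BdryRel C (j, q, s) (j, (q.1 + n₁, q.2 + n₂), s)
  | glue (j : ℤ) (q : ℝ × ℝ) (s : ℝ) : BdryRel C (j, q, s) (j + 1, LogCY.glue (C.k j) q, s)
  | deck (j : ℤ) (q : ℝ × ℝ) (s : ℝ) : BdryRel C (j, q, s) (j + m, q, s + m)

/-- The closed three-manifold `Σ`, a torus bundle over the circle `S = ℝ / mℤ`. -/
def Bdry : Type := Quot C.BdryRel

instance : TopologicalSpace C.Bdry := inferInstanceAs (TopologicalSpace (Quot C.BdryRel))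

/-- The chart of the node `j`, developed over the universal cover of the base. -/
def chart (j : ℤ) (x : (ℝ × ℝ) × ℝ) : C.Bdry := Quot.mk _ (j, x)

/-- The torus-invariant Liouville form of the toric neighbourhood of `D` at the node `j`, in
action-angle coordinates `(q, p)`, where `p = (|z|²/2, |w|²/2)` is the moment map, the symplectic
form is `dp₁ ∧ d(arg z) + dp₂ ∧ d(arg w)`, and `(arg z, arg w) = -2π q`. It is the primitive
`(p₁ - a_j) d(arg z) + (p₂ - a_{j-1}) d(arg w)`, whose residues along `D_j` and `D_{j-1}`
are the ones of `d^c (-log ‖s‖)` for a section `s` with divisor `∑ a_i D_i`. -/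
def toricLiouville (j : ℤ) (x : (ℝ × ℝ) × ℝ × ℝ) : (ℝ × ℝ) × ℝ × ℝ →L[ℝ] ℝ :=
  let dq := ContinuousLinearMap.fst ℝ (ℝ × ℝ) (ℝ × ℝ)
  ((x.2.1 - C.a j) * (-(2 * Real.pi))) • (ContinuousLinearMap.fst ℝ ℝ ℝ).comp dq +
    ((x.2.2 - C.a (j - 1 : ℤ)) * (-(2 * Real.pi))) • (ContinuousLinearMap.snd ℝ ℝ ℝ).comp dq

end PolarizedCycle

/-- A torus-invariant hypersurface near `D`: the union of the torus fibres over a closed path `S` in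
the moment map image, close to the boundary of this image and with rounded corners. Here `ξ j` is
the moment map of the rotation of the fibres of the normal bundle of `D_j` (so `D_j` is `ξ j = 0`),
developed along `S`; near the node `j` the moment map is `(|z|²/2, |w|²/2) = (ξ j, ξ (j - 1))`.
The parameter of the path is such that the node `j` is passed at `s = j`, and `D_j` is
followed for `j ≤ s ≤ j + 1`. -/
structure ToricHypersurface {m : ℕ} (C : PolarizedCycle m) where
  ξ : ℤ → ℝ → ℝ
  smooth : ∀ j, ContDiff ℝ ∞ (ξ j)
  /-- The change of moment coordinates between two consecutive nodes: the toric neighbourhood of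
  `D_j` has the moment image of the disk bundle of degree `k j` over a sphere of area
  `2π (a (j - 1) + k j * a j + a (j + 1))`. -/
  transition : ∀ (j : ℤ) (s : ℝ), ξ (j - 1) s + C.k j * ξ j s + ξ (j + 1) s =
    C.a (j - 1 : ℤ) + C.k j * C.a j + C.a (j + 1 : ℤ)
  closed_path : ∀ (j : ℤ) (s : ℝ), ξ (j + m) (s + m) = ξ j s
  /-- Along `D_j` the path stays inside the toric neighbourhood of `D_j`, away from `D`, and closer
  to `D_j` than `a j`. -/
  near : ∀ (j : ℤ) (s : ℝ), (j : ℝ) ≤ s → s ≤ j + 1 →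
    0 < ξ j s ∧ ξ j s < C.a j ∧ 0 < ξ (j - 1) s ∧ 0 < ξ (j + 1) s

namespace ToricHypersurface

variable {m : ℕ} {C : PolarizedCycle m} (S : ToricHypersurface C)

/-- The inclusion of the hypersurface, in the chart of the node `j`. -/
def incl (j : ℤ) (x : (ℝ × ℝ) × ℝ) : (ℝ × ℝ) × ℝ × ℝ := (x.1, (S.ξ j x.2, S.ξ (j - 1) x.2))

/-- The one-form `e^{u(s)} (λ|_Σ) + h(s) ds` on the hypersurface, in the chart of the node `j`. -/
def form (u h : ℝ → ℝ) (j : ℤ) (x : (ℝ × ℝ) × ℝ) : (ℝ × ℝ) × ℝ →L[ℝ] ℝ :=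
  Real.exp (u x.2) • (C.toricLiouville j (S.incl j x)).comp (fderiv ℝ (S.incl j) x) +
    h x.2 • ContinuousLinearMap.snd ℝ (ℝ × ℝ) ℝ

/-- The Liouville class `A(s) = [α|_{π⁻¹(s)}] ∈ H¹(π⁻¹(s); ℝ)`, as a function on `H_1 = ℝ × ℝ` in
the basis of the node `j` (transported by the Gauss-Manin connection). As `α` is torus-invariant,
its integral over the loop `t ↦ (q + t v, s)`, `0 ≤ t ≤ 1`, is its value on `(v, 0)` at any point
of the fibre. -/
def liouvilleClass (u h : ℝ → ℝ) (j : ℤ) (s : ℝ) : ℝ × ℝ →L[ℝ] ℝ :=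
  (S.form u h j ((0, 0), s)).comp (ContinuousLinearMap.inl ℝ (ℝ × ℝ) ℝ)

end ToricHypersurface

/-- The torus-invariant contact boundary of the Liouville domain: a hypersurface `Σ` as above with
the restriction of a torus-invariant Liouville form, rescaled by a positive function `e^{u}` on
the base so that the Liouville class becomes locally convex. Two torus-invariant primitives of the
symplectic form with the same residues along `D` differ by the pull-back of a closed one-form from
the base; its restriction to the path (with the rescaling) is `h ds`. -/
structure ContactBoundary {m : ℕ} (C : PolarizedCycle m) extends ToricHypersurface C where
  u : ℝ → ℝ
  h : ℝ → ℝ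
  u_smooth : ContDiff ℝ ∞ u
  h_smooth : ContDiff ℝ ∞ h
  u_periodic : ∀ s, u (s + m) = u s
  h_periodic : ∀ s, h (s + m) = h s
  /-- `α ∧ dα` is a positive volume form for the boundary orientation, which is the one of
  `dq₁ ∧ dq₂ ∧ ds`. -/
  contact : ∀ (j : ℤ) (x : (ℝ × ℝ) × ℝ),
    0 < wedgeSelf (toToricHypersurface.form u h j) x ((1, 0), 0) ((0, 1), 0) ((0, 0), 1)
  /-- The path `A` is locally convex with respect to the origin. -/
  locally_convex : ∀ (j : ℤ) (s : ℝ),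
    let A := toToricHypersurface.liouvilleClass u h j
    0 < wedge (deriv A s) (deriv (deriv A) s) / wedge (A s) (deriv A s)

namespace ContactBoundary

variable {m : ℕ} {C : PolarizedCycle m} (B : ContactBoundary C)

/-- The contact form on `Σ`, in the chart of the node `j`. -/
def α (j : ℤ) : (ℝ × ℝ) × ℝ → (ℝ × ℝ) × ℝ →L[ℝ] ℝ := B.toToricHypersurface.form B.u B.h j

/-- The Liouville class of the contact boundary, in the basis of the node `j`. -/
def A (j : ℤ) : ℝ → ℝ × ℝ →L[ℝ] ℝ := B.toToricHypersurface.liouvilleClass B.u B.h j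

/-- The annihilator `A'(s)^⊥` in `H_1(π⁻¹(s); ℝ)` of the derivative of the Liouville class, in the
basis of the node `j`: the line of the directions of the Reeb field on the fibre over `s`. -/
def reebLine (j : ℤ) (s : ℝ) : Submodule ℝ (ℝ × ℝ) := (deriv (B.A j) s).ker

/-- `c` is an integral curve of the Reeb vector field `R`, which is given by `α(R) = 1` and
`ι_R dα = 0`, in the chart of the node `j`. -/
def IsReebCurve (j : ℤ) (c : ℝ → (ℝ × ℝ) × ℝ) : Prop :=
  ∀ t, ∃ R, HasDerivAt c R t ∧ B.α j (c t) R = 1 ∧ ∀ v, dForm (B.α j) (c t) R v = 0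

/-- `T` is a period of some closed Reeb orbit on `Σ`. -/
def IsReebPeriod (T : ℝ) : Prop :=
  0 < T ∧ ∃ (j : ℤ) (c : ℝ → (ℝ × ℝ) × ℝ), B.IsReebCurve j c ∧
    ∀ t, C.chart j (c (t + T)) = C.chart j (c t)

/-- The Liouville form `e^ρ α` of the cylinder `Σ × ℝ`, in the chart of the node `j`. -/
def cylForm (j : ℤ) (y : ((ℝ × ℝ) × ℝ) × ℝ) : ((ℝ × ℝ) × ℝ) × ℝ →L[ℝ] ℝ :=
  Real.exp y.2 • (B.α j y.1).comp (ContinuousLinearMap.fst ℝ ((ℝ × ℝ) × ℝ) ℝ)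

/-- The Hamiltonian `H = (e^ρ)² / 2`, in a chart of the cylinder. -/
def ham (y : ((ℝ × ℝ) × ℝ) × ℝ) : ℝ := (Real.exp y.2) ^ 2 / 2

/-- `c` is an integral curve of the Hamiltonian vector field `X` of `H`, which is given by
`ω(·, X) = dH` with `ω = d(e^ρ α)`, in the chart of the node `j`. -/
def IsHamCurve (j : ℤ) (c : ℝ → ((ℝ × ℝ) × ℝ) × ℝ) : Prop :=
  ∀ t, ∃ X, HasDerivAt c X t ∧ ∀ v, dForm (B.cylForm j) (c t) v X = fderiv ℝ ham (c t) v

/-- The space of the one-periodic orbits of the Hamiltonian `H` in the cylindrical end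
`Σ × [ρ₀, ∞)`, a subspace of the loop space with the compact-open topology. -/
def orbits (ρ₀ : ℝ) : Set C(UnitAddCircle, C.Bdry × ℝ) :=
  {γ | (∃ (j : ℤ) (c : ℝ → ((ℝ × ℝ) × ℝ) × ℝ), B.IsHamCurve j c ∧
      ∀ t : ℝ, γ (t : UnitAddCircle) = (C.chart j (c t).1, (c t).2)) ∧
    ∀ t, ρ₀ ≤ (γ t).2}

/-- The linear loops in the torus fibre over `s` with homology class `v` (in the basis of the
node `j`), at the level where `e^ρ` is the period `∫_v A(s)`. -/
def linearLoops (j : ℤ) (v : ℝ × ℝ) (s : ℝ) : Set C(UnitAddCircle, C.Bdry × ℝ) :=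
  {γ | ∃ q : ℝ × ℝ, ∀ t : ℝ,
    γ (t : UnitAddCircle) = (C.chart j (q + t • v, s), Real.log (B.A j s v))}

end ContactBoundary

end

end LogCY

/-!
In the basis of the node `j` the Liouville class has coordinates `(f j, f (j - 1))`, where
`f j s = 2π e^{u(s)} (a j - ξ j s)` is its value on the normal circle of `D_j`. These functions
satisfy `f (j - 1) + k j * f j + f (j + 1) = 0`, and `f j` is positive on `[j, j + 1]`. The contact
condition says that the class rotates around the origin, and local convexity that its derivative
rotates in the same sense; this is all that the structure `RotatingFamily` records.

Convexity makes every positive critical point of `f j` a strict maximum and every other one a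
strict minimum. Ampleness enters through a discrete Sturm comparison: `a` is a strict supersolution
of the recurrence, so solutions of the recurrence cannot stay positive
(`exists_nonpos_of_recurrence`, `exists_uniform_nonpos`). As the class rotates along with the nodes,
`f j` therefore loses its positivity on both sides of `[j, j + 1]`, and has exactly one critical
point, its peak, on the interval of positivity in between (`RotatingFamily.exists_isPeak`,
`RotatingFamily.IsPeak.unique`). The points `t j` are these peaks. Between the peaks of `f (j - 1)`
and of `f j` the first function decreases and the second one increases
(`RotatingFamily.IsPeak.deriv_pos_between`, `RotatingFamily.IsPeak.deriv_neg_between`), so the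
annihilator of the derivative sweeps out the cone `Q_j`. It does so monotonically, as
`x * f j + y * f (j - 1)` is positive where its derivative vanishes, and so all zeros of this
derivative are crossed downwards (`RotatingFamily.IsPeak.existsUnique`).

The contact form is torus-invariant, so the Reeb field is constant along each torus fibre, and the
Hamiltonian field is `e^ρ` times the Reeb field. Hence all orbits are linear (`isReebCurve_iff`,
`isHamCurve_iff`), and the one-periodic ones are the linear loops in the classes `v` of the lattice
that are annihilated by the derivative of the Liouville class, at the level where `e^ρ` is the
period `ℓ_v`. Each such class is a nonzero point of exactly one cone, up to the identification of
the edges and the deck transformations (`exists_cone`, `eq_of_mem_tropLoops`). The loops in one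
class are the translates of one loop, hence a torus (`exists_torus_parametrization`).

For the topology, the torus bundle is the quotient of one chart by an open equivalence relation
that is closed, so it is Hausdorff (`t2Space_bdry`), and the tori are compact subsets of a Hausdorff
loop space. As `ℓ_v` grows at least linearly in `v` (`exists_linear_lower_bound`), only finitely
many tori lie below any level. Each torus is therefore open in the space of orbits
(`exists_homeomorph`).
-/

namespace LogCY

/-! ### Zeros that are all crossed in the same direction -/

theorem eventually_gt_left_of_deriv_neg {g : ℝ → ℝ} {d x : ℝ} (h : HasDerivAt g d x) (hd : d < 0) :
    ∀ᶠ s in nhdsWithin x (Set.Iio x), g x < g s := by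
  have h1 := (hasDerivAt_iff_tendsto_slope.1 h).eventually_lt_const hd
  have h2 : ∀ᶠ s in nhdsWithin x (Set.Iio x), slope g x s < 0 :=
    h1.filter_mono (nhdsWithin_mono _ fun s hs => ne_of_lt hs)
  filter_upwards [h2, self_mem_nhdsWithin] with s hs hsx
  rw [slope_def_field] at hs
  have hsx' : s - x < 0 := sub_neg.2 hsx
  by_contra! hc
  exact absurd (div_nonneg_of_nonpos (sub_nonpos.2 hc) hsx'.le) (not_le.2 hs)

/-- A function whose zeros are all crossed downwards stays negative after its first nonpositive
value. -/
theorem neg_of_zeros_down {g g' : ℝ → ℝ} {x y : ℝ} (hg : ∀ s, HasDerivAt g (g' s) s)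
    (h0 : ∀ s ∈ Set.Icc x y, g s = 0 → g' s < 0) (hx : g x ≤ 0) :
    ∀ s ∈ Set.Ioc x y, g s < 0 := by
  have hle : ∀ s ∈ Set.Icc x y, g s ≤ 0 := fun s hs =>
    image_le_of_deriv_right_lt_deriv_boundary (f := g) (f' := g') (B := fun _ => 0)
      (B' := fun _ => 0) (fun s _ => (hg s).continuousAt.continuousWithinAt)
      (fun s _ => (hg s).hasDerivWithinAt) hx (fun s => hasDerivAt_const s 0)
      (fun s hs h => h0 s ⟨hs.1, hs.2.le⟩ h) hs
  intro s hs
  refine lt_of_le_of_ne (hle s ⟨hs.1.le, hs.2⟩) fun hz => ?_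
  have h1 := eventually_gt_left_of_deriv_neg (hg s) (h0 s ⟨hs.1.le, hs.2⟩ hz)
  obtain ⟨r, hr, hr1, hr2⟩ := (h1.and (Ioo_mem_nhdsLT hs.1)).exists
  have := hle r ⟨hr1.le, hr2.le.trans hs.2⟩
  linarith

theorem pos_of_zeros_up {g g' : ℝ → ℝ} {x y : ℝ} (hg : ∀ s, HasDerivAt g (g' s) s)
    (h0 : ∀ s ∈ Set.Icc x y, g s = 0 → 0 < g' s) (hx : 0 ≤ g x) :
    ∀ s ∈ Set.Ioc x y, 0 < g s := by
  intro s hs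
  have := neg_of_zeros_down (g := fun s => - g s) (g' := fun s => - g' s) (fun s => (hg s).neg)
    (fun r hr h => neg_neg_of_pos (h0 r hr (neg_eq_zero.1 h))) (neg_nonpos.2 hx) s hs
  exact neg_neg_iff_pos.1 this

theorem pos_of_zeros_down {g g' : ℝ → ℝ} {x y : ℝ} (hg : ∀ s, HasDerivAt g (g' s) s)
    (h0 : ∀ s ∈ Set.Icc x y, g s = 0 → g' s < 0) (hy : 0 ≤ g y) :
    ∀ s ∈ Set.Ico x y, 0 < g s := by
  intro s hs
  have hd : ∀ r, HasDerivAt (fun r => - g (-r)) (g' (-r)) r := fun r => by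
    have := ((hg (-r)).comp r (hasDerivAt_neg r)).neg
    exact this.congr_deriv (by simp)
  have := neg_of_zeros_down (x := -y) (y := -x) hd
    (fun r hr h => h0 (-r) ⟨by linarith [hr.2], by linarith [hr.1]⟩ (neg_eq_zero.1 h))
    (by simpa using hy) (-s) ⟨by linarith [hs.2], by linarith [hs.1]⟩
  simpa using this

theorem exists_first_zero {f : ℝ → ℝ} {x y : ℝ} (hf : Continuous f) (hxy : x ≤ y) (hx : 0 < f x)
    (hy : f y ≤ 0) : ∃ b, x < b ∧ f b = 0 ∧ ∀ s ∈ Set.Ico x b, 0 < f s := by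
  have hc : IsCompact (Set.Icc x y ∩ f ⁻¹' Set.Iic 0) :=
    isCompact_Icc.inter_right (isClosed_Iic.preimage hf)
  obtain ⟨b, ⟨hb1, hb2⟩, hb3⟩ := hc.exists_isLeast ⟨y, ⟨hxy, le_rfl⟩, hy⟩
  have hpos : ∀ s ∈ Set.Ico x b, 0 < f s := fun s hs => by
    by_contra! h
    exact absurd (hb3 ⟨⟨hs.1, hs.2.le.trans hb1.2⟩, h⟩) (not_le.2 hs.2)
  have hxb : x < b := lt_of_le_of_ne hb1.1 fun h => by
    have h2 : f b ≤ 0 := hb2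
    rw [← h] at h2; linarith
  refine ⟨b, hxb, ?_, hpos⟩
  obtain ⟨c, hc1, hc2⟩ := intermediate_value_Icc' hb1.1 hf.continuousOn ⟨hb2, hx.le⟩
  have : b ≤ c := hb3 ⟨⟨hc1.1, hc1.2.trans hb1.2⟩, hc2.le⟩
  rwa [le_antisymm this hc1.2]

/-! ### Oscillation of the recurrence defined by the normal degrees -/

theorem exists_nonpos_of_le_sub {x : ℕ → ℝ} {ε : ℝ} (hε : 0 < ε) (h : ∀ n, x (n + 1) ≤ x n - ε) :
    ∃ n, x n ≤ 0 := by
  have h1 : ∀ n : ℕ, x n ≤ x 0 - n * ε := fun n => by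
    induction n with
    | zero => simp
    | succ n ih => push_cast; linarith [h n]
  obtain ⟨n, hn⟩ := exists_nat_ge (x 0 / ε)
  refine ⟨n, (h1 n).trans ?_⟩
  rw [div_le_iff₀ hε] at hn
  linarith

/-- Discrete Sturm comparison with the strict supersolution `a`: the Wronskian of `φ` and `a`
decreases as long as `φ` is positive, so `φ / a` is concave in the discrete sense and cannot stay
positive. -/
theorem exists_nonpos_of_recurrence {k a φ : ℕ → ℝ} {lo hi δ : ℝ} (hlo : 0 < lo) (hδ : 0 < δ)
    (ha : ∀ n, lo ≤ a n) (ha' : ∀ n, a n ≤ hi)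
    (hd : ∀ n, δ ≤ a n + k (n + 1) * a (n + 1) + a (n + 2))
    (hφ : ∀ n, φ n + k (n + 1) * φ (n + 1) + φ (n + 2) = 0) : ∃ n, 1 ≤ n ∧ φ n ≤ 0 := by
  by_contra! hpos
  have hapos : ∀ n, 0 < a n := fun n => hlo.trans_le (ha n)
  have hhi : 0 < hi := (hapos 0).trans_le (ha' 0)
  -- the Wronskian of `φ` and `a`; it also gives the increments of `φ / a`
  set w : ℕ → ℝ := fun n => φ (n + 1) * a n - φ n * a (n + 1) with hw
  have hstep : ∀ n, w (n + 1) ≤ w n - δ * φ (n + 1) := fun n => by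
    have h1 : w (n + 1) = w n - φ (n + 1) * (a n + k (n + 1) * a (n + 1) + a (n + 2)) := by
      have : φ (n + 2) = - φ n - k (n + 1) * φ (n + 1) := by linarith [hφ n]
      simp only [hw, show n + 1 + 1 = n + 2 from rfl, this]; ring
    have h2 := mul_le_mul_of_nonneg_left (hd n) (hpos (n + 1) (by omega)).le
    linarith
  have hr : ∀ n, φ (n + 1) / a (n + 1) = φ n / a n + w n / (a n * a (n + 1)) := fun n => by
    have := (hapos n).ne'; have := (hapos (n + 1)).ne'
    simp only [hw]; field_simp; ring
  by_cases hA : ∀ n, 1 ≤ n → 0 < w n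
  -- if `φ / a` keeps increasing, then `φ` is bounded below, so `w` decreases at a linear rate
  · have hc : ∀ n, φ 1 / a 1 ≤ φ (n + 1) / a (n + 1) := fun n => by
      induction n with
      | zero => simp
      | succ n ih =>
        have := div_pos (hA (n + 1) (by omega)) (mul_pos (hapos (n + 1)) (hapos (n + 2)))
        rw [hr (n + 1)]; exact ih.trans (by linarith)
    have hc0 : 0 < φ 1 / a 1 := div_pos (hpos 1 le_rfl) (hapos 1)
    obtain ⟨n, hn⟩ := exists_nonpos_of_le_sub (x := fun n => w (n + 1))
      (ε := δ * (φ 1 / a 1 * lo)) (by positivity) (fun n => by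
        have h1 : φ 1 / a 1 * lo ≤ φ (n + 2) := by
          have h2 := (le_div_iff₀ (hapos (n + 2))).1 (hc (n + 1))
          exact (mul_le_mul_of_nonneg_left (ha _) hc0.le).trans h2
        have := mul_le_mul_of_nonneg_left h1 hδ.le
        exact (hstep (n + 1)).trans (by linarith))
    exact absurd (hA (n + 1) (by omega)) (not_lt.2 hn)
  -- once `w` is negative, it stays away from zero, so `φ / a` decreases at a linear rate
  · push Not at hA
    obtain ⟨n, hn, hwn⟩ := hA
    have hw1 : w (n + 1) < 0 := by
      have := mul_pos hδ (hpos (n + 1) (by omega))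
      linarith [hstep n]
    have hw2 : ∀ i, w (n + 1 + i) ≤ w (n + 1) := fun i => by
      induction i with
      | zero => simp
      | succ i ih =>
        have := mul_pos hδ (hpos (n + 1 + i + 1) (by omega))
        have := hstep (n + 1 + i)
        rw [← add_assoc]; linarith
    obtain ⟨i, hi'⟩ := exists_nonpos_of_le_sub (x := fun i => φ (n + 1 + i) / a (n + 1 + i))
      (ε := - w (n + 1) / (hi * hi)) (by have := neg_pos.2 hw1; positivity) (fun i => by
        have h1 := hr (n + 1 + i)
        simp only [← add_assoc]
        rw [h1]
        have h2 : a (n + 1 + i) * a (n + 1 + i + 1) ≤ hi * hi :=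
          mul_le_mul (ha' _) (ha' _) (hapos _).le hhi.le
        have h3 : - w (n + 1) / (hi * hi) ≤ - w (n + 1 + i) / (a (n + 1 + i) * a (n + 1 + i + 1)) :=
          div_le_div₀ (by linarith [hw2 i]) (by linarith [hw2 i])
            (mul_pos (hapos _) (hapos _)) h2
        rw [neg_div (_ * _) (w (n + 1 + i))] at h3
        linarith)
    exact absurd (div_pos (hpos (n + 1 + i) (by omega)) (hapos _)) (not_lt.2 hi')

/-- The solution of `φ n + k (n + 1) * φ (n + 1) + φ (n + 2) = 0` with `φ 0 = 0` and `φ 1 = 1`,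
together with its successor. -/
noncomputable def fundamentalSol (k : ℕ → ℝ) : ℕ → ℝ × ℝ
  | 0 => (0, 1)
  | n + 1 => ((fundamentalSol k n).2,
      - (fundamentalSol k n).1 - k (n + 1) * (fundamentalSol k n).2)

/-- Solutions of the recurrence oscillate uniformly. By Sturm separation, the first nonpositive
term of the solution that starts with `0`, `1` bounds the number of consecutive positive terms of
any other solution. -/
theorem exists_uniform_nonpos {k a : ℕ → ℝ} {lo hi δ : ℝ} (hlo : 0 < lo) (hδ : 0 < δ)
    (ha : ∀ n, lo ≤ a n) (ha' : ∀ n, a n ≤ hi)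
    (hd : ∀ n, δ ≤ a n + k (n + 1) * a (n + 1) + a (n + 2)) :
    ∃ N : ℕ, ∀ f : ℕ → ℝ, (∀ n, f n + k (n + 1) * f (n + 1) + f (n + 2) = 0) →
      ∃ l ≤ N, f l ≤ 0 := by
  set φ : ℕ → ℝ := fun n => (fundamentalSol k n).1 with hφdef
  have hφ2 : ∀ n, φ (n + 2) = - φ n - k (n + 1) * φ (n + 1) := fun n => rfl
  have hφ0 : φ 0 = 0 := rfl
  have hφ1 : φ 1 = 1 := rfl
  have hex := exists_nonpos_of_recurrence (φ := φ) hlo hδ ha ha' hd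
    (fun n => by rw [hφ2]; ring)
  classical
  obtain ⟨hN1, hN2⟩ := Nat.find_spec hex
  have hN3 : ∀ n, 1 ≤ n → n < Nat.find hex → 0 < φ n := fun n hn hlt => by
    have := Nat.find_min hex hlt
    push Not at this
    exact this hn
  set N := Nat.find hex
  refine ⟨N, fun f hf => ?_⟩
  by_contra! hpos
  -- the Wronskian of two solutions is constant
  have hc : ∀ n, f (n + 1) * φ n - f n * φ (n + 1) = - f 0 := fun n => by
    induction n with
    | zero => rw [hφ0, zero_add, hφ1]; ring
    | succ n ih =>
      have : f (n + 2) = - f n - k (n + 1) * f (n + 1) := by linarith [hf n]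
      rw [show n + 1 + 1 = n + 2 from rfl, hφ2, this, ← ih]; ring
  have hN4 : 2 ≤ N := by
    by_contra! h
    have : N = 1 := by omega
    rw [this, hφ1] at hN2; linarith
  have h1 := hc (N - 1)
  rw [Nat.sub_add_cancel hN1] at h1
  have h2 := mul_pos (hpos N le_rfl) (hN3 (N - 1) (by omega) (by omega))
  have h3 := mul_nonneg (hpos (N - 1) (by omega)).le (neg_nonneg.2 hN2)
  have h4 := hpos 0 (by omega)
  linarith

/-! ### Convex families rotating with the nodes -/

/-- The coordinates `f j` of a plane curve `A` that rotates around the origin and is locally convex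
with respect to it, in a sequence of bases which rotates along with `A`: `A` has coordinates
`(f j, f (j - 1))` in the `j`-th basis, `f'` and `f''` are the first two derivatives, and
consecutive bases are related by the recurrence with coefficients `k`. The sequence `a` is a strict
supersolution of this recurrence; the constants `lo`, `hi`, `δ` bound it and its defect uniformly,
in place of periodicity. -/
structure RotatingFamily where
  f : ℤ → ℝ → ℝ
  f' : ℤ → ℝ → ℝ
  f'' : ℤ → ℝ → ℝ
  k : ℤ → ℝ
  a : ℤ → ℝ
  lo : ℝ
  hi : ℝ
  δ : ℝ
  hasDeriv : ∀ j s, HasDerivAt (f j) (f' j s) s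
  hasDeriv' : ∀ j s, HasDerivAt (f' j) (f'' j s) s
  lo_pos : 0 < lo
  δ_pos : 0 < δ
  lo_le : ∀ j, lo ≤ a j
  le_hi : ∀ j, a j ≤ hi
  supersol : ∀ j, δ ≤ a (j - 1) + k j * a j + a (j + 1)
  recurrence : ∀ j s, f (j - 1) s + k j * f j s + f (j + 1) s = 0
  pos : ∀ (j : ℤ) (s : ℝ), (j : ℝ) ≤ s → s ≤ j + 1 → 0 < f j s
  rotating : ∀ j s, 0 < f (j - 1) s * f' j s - f j s * f' (j - 1) s
  convex : ∀ j s, 0 < f' (j - 1) s * f'' j s - f' j s * f'' (j - 1) s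

namespace RotatingFamily

variable (F : RotatingFamily)

/-- The family traversed in the opposite direction. -/
def reflect : RotatingFamily where
  f j s := F.f (-j) (1 - s)
  f' j s := - F.f' (-j) (1 - s)
  f'' j s := F.f'' (-j) (1 - s)
  k j := F.k (-j)
  a j := F.a (-j)
  lo := F.lo
  hi := F.hi
  δ := F.δ
  hasDeriv j s := by
    have := (F.hasDeriv (-j) (1 - s)).comp s ((hasDerivAt_id s).const_sub 1)
    exact this.congr_deriv (by simp)
  hasDeriv' j s := by
    have := ((F.hasDeriv' (-j) (1 - s)).comp s ((hasDerivAt_id s).const_sub 1)).neg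
    exact this.congr_deriv (by simp)
  lo_pos := F.lo_pos
  δ_pos := F.δ_pos
  lo_le j := F.lo_le _
  le_hi j := F.le_hi _
  supersol j := by
    have := F.supersol (-j)
    rw [show -(j - 1) = -j + 1 by ring, show -(j + 1) = -j - 1 by ring]; linarith
  recurrence j s := by
    have := F.recurrence (-j) (1 - s)
    rw [show -(j - 1) = -j + 1 by ring, show -(j + 1) = -j - 1 by ring]; linarith
  pos j s h1 h2 := F.pos _ _ (by push_cast; linarith) (by push_cast; linarith)
  rotating j s := by
    have := F.rotating (-j + 1) (1 - s)
    rw [show -j + 1 - 1 = -j by ring] at this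
    rw [show -(j - 1) = -j + 1 by ring]; linarith
  convex j s := by
    have := F.convex (-j + 1) (1 - s)
    rw [show -j + 1 - 1 = -j by ring] at this
    rw [show -(j - 1) = -j + 1 by ring]; linarith

theorem continuous (j : ℤ) : Continuous (F.f j) :=
  continuous_iff_continuousAt.2 fun s => (F.hasDeriv j s).continuousAt

/-- Where `f (i - 1)` is positive, the quotient `f i / f (i - 1)` increases. -/
theorem pos_right {i : ℤ} {x y : ℝ} (h : ∀ s ∈ Set.Icc x y, 0 < F.f (i - 1) s)
    (hx : 0 ≤ F.f i x) : ∀ s ∈ Set.Ioc x y, 0 < F.f i s :=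
  pos_of_zeros_up (F.hasDeriv i) (fun s hs h0 => by
    have h1 := F.rotating i s
    rw [h0] at h1
    have h2 := h s hs
    by_contra! h3
    nlinarith) hx

/-- Where `f i` is positive, the quotient `f (i - 1) / f i` decreases. -/
theorem pos_left {i : ℤ} {x y : ℝ} (h : ∀ s ∈ Set.Icc x y, 0 < F.f i s)
    (hy : 0 ≤ F.f (i - 1) y) : ∀ s ∈ Set.Ico x y, 0 < F.f (i - 1) s :=
  pos_of_zeros_down (F.hasDeriv (i - 1)) (fun s hs h0 => by
    have h1 := F.rotating i s
    rw [h0] at h1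
    have h2 := h s hs
    by_contra! h3
    nlinarith) hy

/-- If `f j` stayed positive to the right of the node `j`, then so would `f (j + n)` to the right of
the node `j + n`, for all `n`. Over a distant node, this would give a solution of the recurrence with
too many consecutive positive terms. -/
theorem exists_nonpos_right (j : ℤ) : ∃ s : ℝ, j ≤ s ∧ F.f j s ≤ 0 := by
  by_contra! hpos
  obtain ⟨N, hN⟩ := exists_uniform_nonpos (k := fun n => F.k (j + n)) (a := fun n => F.a (j + n))
    F.lo_pos F.δ_pos (fun n => F.lo_le _) (fun n => F.le_hi _) (fun n => by
      have := F.supersol (j + n + 1)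
      push_cast
      rw [show j + n + 1 - 1 = j + (n : ℤ) by ring, show j + n + 1 + 1 = j + ((n : ℤ) + 2) by ring]
        at this
      rwa [← add_assoc])
  have key : ∀ n : ℕ, ∀ s : ℝ, j + n ≤ s → 0 < F.f (j + n) s := fun n => by
    induction n with
    | zero => simpa using hpos
    | succ n ih =>
      intro s hs
      push_cast at hs ⊢
      have h0 : 0 < F.f (j + (n + 1)) (j + (n + 1)) :=
        F.pos _ _ (by push_cast; linarith) (by push_cast; linarith)
      rcases hs.eq_or_lt with rfl | hs
      · exact h0
      · refine F.pos_right (i := j + (n + 1)) (x := j + (n + 1)) (y := s) (fun r hr => ?_) h0.le s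
          ⟨hs, le_rfl⟩
        rw [show j + ((n : ℤ) + 1) - 1 = j + n by ring]
        exact ih r (by linarith [hr.1])
  obtain ⟨l, hl, hl'⟩ := hN (fun n => F.f (j + n) (j + N)) (fun n => by
    have := F.recurrence (j + n + 1) (j + N)
    push_cast
    rw [show j + n + 1 - 1 = j + (n : ℤ) by ring, show j + n + 1 + 1 = j + ((n : ℤ) + 2) by ring]
      at this
    rwa [← add_assoc])
  have : (l : ℝ) ≤ N := by exact_mod_cast hl
  exact absurd (key l (j + N) (by linarith)) (not_lt.2 hl')

theorem exists_nonpos_left (j : ℤ) : ∃ s : ℝ, s ≤ j + 1 ∧ F.f j s ≤ 0 := by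
  obtain ⟨s, hs, h⟩ := F.reflect.exists_nonpos_right (-j)
  refine ⟨1 - s, by push_cast at hs; linarith, ?_⟩
  simpa [reflect] using h

/-- `t` is the maximum point of `f j` on the interval around `[j, j + 1]` where `f j` is
positive. -/
def IsPeak (j : ℤ) (t : ℝ) : Prop := F.f' j t = 0 ∧ ∀ s ∈ Set.uIcc (j : ℝ) t, 0 < F.f j s

theorem exists_isPeak (j : ℤ) : ∃ t, F.IsPeak j t := by
  have hj : 0 < F.f j j := F.pos j j le_rfl (by linarith)
  obtain ⟨y, hy, hy'⟩ := F.exists_nonpos_right j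
  obtain ⟨b, hb, hb0, hbpos⟩ := exists_first_zero (F.continuous j) hy hj hy'
  obtain ⟨x, hx, hx'⟩ := F.exists_nonpos_left j
  have hxj : x ≤ j := by
    by_contra! h
    exact absurd (F.pos j x h.le hx) (not_lt.2 hx')
  obtain ⟨c, hc, hc0, hcpos⟩ := exists_first_zero (f := fun s => F.f j (-s)) (x := -j) (y := -x)
    ((F.continuous j).comp continuous_neg) (by linarith) (by simpa using hj) (by simpa using hx')
  obtain ⟨t, ht, ht0⟩ := exists_hasDerivAt_eq_zero (f := F.f j) (f' := F.f' j) (a := -c) (b := b)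
    (by linarith) (F.continuous j).continuousOn (hc0.trans hb0.symm) (fun s _ => F.hasDeriv j s)
  refine ⟨t, ht0, fun s hs => ?_⟩
  rcases le_total (j : ℝ) s with h | h
  · refine hbpos s ⟨h, ?_⟩
    rcases Set.mem_uIcc.1 hs with h1 | h1 <;> linarith [ht.2]
  · have := hcpos (-s) ⟨by linarith, by rcases Set.mem_uIcc.1 hs with h1 | h1 <;> linarith [ht.1]⟩
    simpa using this

theorem second_deriv_neg {j : ℤ} {s : ℝ} (h0 : F.f' j s = 0) (h : 0 < F.f j s) :
    F.f'' j s < 0 := by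
  have h1 := F.rotating j s
  have h2 := F.convex j s
  rw [h0] at h1 h2
  have h3 : F.f' (j - 1) s < 0 := by by_contra! h3; nlinarith
  by_contra! h4
  nlinarith

theorem second_deriv_pos {j : ℤ} {s : ℝ} (h0 : F.f' j s = 0) (h : F.f j s ≤ 0) :
    0 < F.f'' j s := by
  have h1 := F.rotating j s
  have h2 := F.convex j s
  rw [h0] at h1 h2
  have h3 : 0 < F.f' (j - 1) s := by by_contra! h3; nlinarith
  by_contra! h4
  nlinarith

variable {F}

theorem IsPeak.pos {j : ℤ} {t : ℝ} (h : F.IsPeak j t) : 0 < F.f j t := h.2 t Set.right_mem_uIcc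

theorem IsPeak.pos_of_mem {j : ℤ} {t s : ℝ} (h : F.IsPeak j t) (h1 : j ≤ s) (h2 : s ≤ t) :
    0 < F.f j s := h.2 s (Set.mem_uIcc.2 (Or.inl ⟨h1, h2⟩))

/-- Unlike `IsPeak.pos_of_mem`, this extends to the far end `j + 1` of the interval of `D_j`, as `f j`
is positive on all of `[j, j + 1]`. -/
theorem IsPeak.pos_of_mem' {j : ℤ} {t s : ℝ} (h : F.IsPeak j t) (h1 : t ≤ s) (h2 : s ≤ j + 1) :
    0 < F.f j s := by
  rcases le_total (j : ℝ) s with h3 | h3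
  · exact F.pos j s h3 h2
  · exact h.2 s (Set.mem_uIcc.2 (Or.inr ⟨h1, h3⟩))

theorem IsPeak.deriv_pos {j : ℤ} {t s : ℝ} (h : F.IsPeak j t) (hs : s < t)
    (hp : ∀ r ∈ Set.Icc s t, 0 < F.f j r) : 0 < F.f' j s :=
  pos_of_zeros_down (F.hasDeriv' j) (fun r hr h0 => F.second_deriv_neg h0 (hp r hr)) h.1.ge s
    ⟨le_rfl, hs⟩

theorem IsPeak.deriv_neg {j : ℤ} {t s : ℝ} (h : F.IsPeak j t) (hs : t < s)
    (hp : ∀ r ∈ Set.Icc t s, 0 < F.f j r) : F.f' j s < 0 :=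
  neg_of_zeros_down (F.hasDeriv' j) (fun r hr h0 => F.second_deriv_neg h0 (hp r hr)) h.1.le s
    ⟨hs, le_rfl⟩

theorem IsPeak.unique {j : ℤ} {t t' : ℝ} (h : F.IsPeak j t) (h' : F.IsPeak j t') : t = t' := by
  wlog hlt : t < t' generalizing t t'
  · rcases (not_lt.1 hlt).eq_or_lt with e | l
    · exact e.symm
    · exact (this h' h l).symm
  have h1 : 0 < F.f' j t := h'.deriv_pos hlt fun r hr => by
    rcases le_total (j : ℝ) r with h3 | h3
    · exact h'.pos_of_mem h3 hr.2
    · exact h.pos_of_mem' hr.1 (by linarith)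
  exact absurd h.1 h1.ne'

theorem IsPeak.prev_deriv_neg {j : ℤ} {t : ℝ} (h : F.IsPeak j t) : F.f' (j - 1) t < 0 := by
  have h1 := F.rotating j t
  rw [h.1] at h1
  have := h.pos
  by_contra! h3
  nlinarith

theorem IsPeak.next_deriv_pos {j : ℤ} {t : ℝ} (h : F.IsPeak (j - 1) t) : 0 < F.f' j t := by
  have h1 := F.rotating j t
  rw [h.1] at h1
  have := h.pos
  by_contra! h3
  nlinarith

theorem IsPeak.lt {j : ℤ} {t t' : ℝ} (h : F.IsPeak (j - 1) t) (h' : F.IsPeak j t') : t < t' := by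
  by_contra! hle
  have hneg := h'.prev_deriv_neg
  rcases hle.eq_or_lt with e | hlt
  · rw [e, h.1] at hneg; exact lt_irrefl _ hneg
  refine absurd (h.deriv_pos hlt fun r hr => ?_) (not_lt.2 hneg.le)
  have hj : 0 < F.f (j - 1) j := F.pos _ _ (by push_cast; linarith) (by push_cast; linarith)
  rcases le_or_gt (j : ℝ) r with h3 | h3
  · exact h.pos_of_mem (by push_cast; linarith) hr.2
  · exact F.pos_left (x := t') (y := j) (fun q hq => h'.pos_of_mem' hq.1 (by linarith [hq.2])) hj.le r
      ⟨hr.1, h3⟩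

/-- Between the peaks of `f (j - 1)` and of `f j`, the function `f j` increases. If it becomes
negative there, then its critical points in the negative part are minima, and it has none as it
increases at the peak of `f (j - 1)`. -/
theorem IsPeak.deriv_pos_between {j : ℤ} {t t' s : ℝ} (h : F.IsPeak (j - 1) t)
    (h' : F.IsPeak j t') (h1 : t ≤ s) (h2 : s < t') : 0 < F.f' j s := by
  by_cases hp : ∀ r ∈ Set.Icc s t', 0 < F.f j r
  · exact h'.deriv_pos h2 hp
  push Not at hp
  obtain ⟨z, hz, hz0⟩ := hp
  have hzj : z < j := by
    by_contra! hc
    exact absurd (h'.pos_of_mem hc hz.2) (not_lt.2 hz0)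
  have hneg : ∀ r ∈ Set.Icc t z, F.f j r ≤ 0 := fun r hr => by
    by_contra! hc
    rcases hr.2.eq_or_lt with e | hlt
    · rw [e] at hc; linarith
    · exact absurd (F.pos_right (x := r) (y := z) (fun q hq =>
        h.pos_of_mem' (hr.1.trans hq.1) (by push_cast; linarith [hq.2])) hc.le z ⟨hlt, le_rfl⟩)
        (not_lt.2 hz0)
  have ht := h.next_deriv_pos
  rcases h1.eq_or_lt with e | hlt
  · rwa [← e]
  · exact pos_of_zeros_up (x := t) (y := z) (F.hasDeriv' j)
      (fun r hr h0 => F.second_deriv_pos h0 (hneg r hr)) ht.le s ⟨hlt, hz.1⟩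

theorem IsPeak.reflect {j : ℤ} {t : ℝ} (h : F.IsPeak j t) : F.reflect.IsPeak (-j) (1 - t) := by
  refine ⟨by simp [RotatingFamily.reflect, h.1], fun s hs => ?_⟩
  simp only [RotatingFamily.reflect, neg_neg]
  push_cast at hs
  rcases Set.mem_uIcc.1 hs with h1 | h1
  · exact h.pos_of_mem' (by linarith) (by linarith)
  · rcases le_total (1 - s) (j + 1) with h2 | h2
    · exact F.pos _ _ (by linarith) h2
    · exact h.pos_of_mem (by linarith) (by linarith)

theorem IsPeak.deriv_neg_between {j : ℤ} {t t' s : ℝ} (h : F.IsPeak (j - 1) t)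
    (h' : F.IsPeak j t') (h1 : t < s) (h2 : s ≤ t') : F.f' (j - 1) s < 0 := by
  have hr : F.reflect.IsPeak (-(j - 1) - 1) (1 - t') := by
    rw [show -(j - 1) - 1 = -j by ring]; exact h'.reflect
  have := hr.deriv_pos_between h.reflect (s := 1 - s) (by linarith) (by linarith)
  simpa [RotatingFamily.reflect] using this

theorem IsPeak.deriv_sub_pos {j : ℤ} {t t' s : ℝ} (h : F.IsPeak (j - 1) t)
    (h' : F.IsPeak j t') (h1 : t ≤ s) (h2 : s ≤ t') : 0 < F.f' j s - F.f' (j - 1) s := by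
  rcases h2.eq_or_lt with e | hlt
  · have := h'.prev_deriv_neg
    rw [e, h'.1]; linarith
  · have h3 := h.deriv_pos_between h' h1 hlt
    rcases h1.eq_or_lt with e | hlt'
    · rw [← e, h.1]; rw [← e] at h3; linarith
    · linarith [h.deriv_neg_between h' hlt' h2]

/-- Where the derivative of `x * f j + y * f (j - 1)` vanishes, this function is
`x + y` times a quantity that does not depend on `x` and `y`. -/
theorem value_of_deriv_eq_zero {j : ℤ} {s x y : ℝ} (h : x * F.f' j s + y * F.f' (j - 1) s = 0) :
    (x * F.f j s + y * F.f (j - 1) s) * (F.f' j s - F.f' (j - 1) s) =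
      (x + y) * (F.f (j - 1) s * F.f' j s - F.f j s * F.f' (j - 1) s) := by
  linear_combination (F.f j s - F.f (j - 1) s) * h

theorem IsPeak.value_pos {j : ℤ} {t t' s x y : ℝ} (h : F.IsPeak (j - 1) t)
    (h' : F.IsPeak j t') (h1 : t ≤ s) (h2 : s ≤ t') (hxy : 0 < x + y)
    (h0 : x * F.f' j s + y * F.f' (j - 1) s = 0) : 0 < x * F.f j s + y * F.f (j - 1) s := by
  have h3 := h.deriv_sub_pos h' h1 h2
  have h4 := value_of_deriv_eq_zero h0
  exact pos_of_mul_pos_left (h4 ▸ mul_pos hxy (F.rotating j s)) h3.le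

/-- The derivative of `A` along a direction changes sign where it vanishes, in the sense opposite
to the sign of `A` along this direction. -/
theorem second_deriv_neg_of_direction {j : ℤ} {s x y : ℝ} (h0 : x * F.f' j s + y * F.f' (j - 1) s = 0)
    (h : 0 < x * F.f j s + y * F.f (j - 1) s) : x * F.f'' j s + y * F.f'' (j - 1) s < 0 := by
  have hW := F.rotating j s
  have hV := F.convex j s
  set p := F.f j s
  set q := F.f (j - 1) s
  set p' := F.f' j s
  set q' := F.f' (j - 1) s
  set p'' := F.f'' j s
  set q'' := F.f'' (j - 1) s
  -- compare with the values in the orthogonal direction `(-y, x)`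
  have e1 : (x * p + y * q) * (x * q' - y * p') = - (x * x + y * y) * (q * p' - p * q') := by
    linear_combination (x * q - y * p) * h0
  have e2 : (x * p'' + y * q'') * (x * q' - y * p') = (x * x + y * y) * (q' * p'' - p' * q'') := by
    linear_combination (x * q'' - y * p'') * h0
  have hxy : 0 < x * x + y * y := by
    rcases eq_or_ne x 0 with rfl | hx
    · rcases eq_or_ne y 0 with rfl | hy
      · simp at h
      · have := mul_self_pos.2 hy; linarith
    · have := mul_self_pos.2 hx; nlinarith [mul_self_nonneg y]
  have h1 : x * q' - y * p' < 0 := by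
    by_contra! hc
    have := mul_nonneg h.le hc
    have := mul_pos hxy hW
    linarith
  by_contra! hc
  have h2 := mul_nonneg hc (neg_nonneg.2 h1.le)
  have h3 := mul_pos hxy hV
  linarith

theorem IsPeak.existsUnique {j : ℤ} {t t' x y : ℝ} (h : F.IsPeak (j - 1) t)
    (h' : F.IsPeak j t') (hx : 0 ≤ x) (hy : 0 ≤ y) (hxy : 0 < x + y) :
    ∃! s, s ∈ Set.Icc t t' ∧ x * F.f' j s + y * F.f' (j - 1) s = 0 := by
  have hlt := h.lt h'
  have hd : ∀ s, HasDerivAt (fun s => x * F.f' j s + y * F.f' (j - 1) s)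
      (x * F.f'' j s + y * F.f'' (j - 1) s) s := fun s =>
    ((F.hasDeriv' j s).const_mul x).add ((F.hasDeriv' (j - 1) s).const_mul y)
  have hdown : ∀ s ∈ Set.Icc t t', x * F.f' j s + y * F.f' (j - 1) s = 0 →
      x * F.f'' j s + y * F.f'' (j - 1) s < 0 := fun s hs h0 =>
    second_deriv_neg_of_direction h0 (h.value_pos h' hs.1 hs.2 hxy h0)
  have ht : 0 ≤ x * F.f' j t + y * F.f' (j - 1) t := by
    rw [h.1]; have := mul_nonneg hx h.next_deriv_pos.le; linarith
  have ht' : x * F.f' j t' + y * F.f' (j - 1) t' ≤ 0 := by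
    rw [h'.1]; have := mul_nonneg hy (neg_nonneg.2 h'.prev_deriv_neg.le); linarith
  obtain ⟨s, hs, hs0⟩ := intermediate_value_Icc' hlt.le
    (fun s _ => (hd s).continuousAt.continuousWithinAt) ⟨ht', ht⟩
  refine ⟨s, ⟨hs, hs0⟩, fun r ⟨hr, hr0⟩ => ?_⟩
  rcases lt_trichotomy r s with hlt | e | hlt
  · exact absurd hs0 (neg_of_zeros_down hd (fun q hq => hdown q ⟨hr.1.trans hq.1, hq.2.trans hs.2⟩)
      hr0.le s ⟨hlt, le_rfl⟩).ne
  · exact e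
  · exact absurd hr0 (neg_of_zeros_down hd (fun q hq => hdown q ⟨hs.1.trans hq.1, hq.2.trans hr.2⟩)
      hs0.le r ⟨hlt, le_rfl⟩).ne

/-- If the derivative of `A` vanishes in a direction inside the `j`-th cone over the point `j`,
then this point lies strictly between the two peaks. -/
theorem IsPeak.mem_Ioo {j : ℤ} {t t' x y : ℝ} (h : F.IsPeak (j - 1) t) (h' : F.IsPeak j t')
    (hx : 0 < x) (hy : 0 < y) (h0 : x * F.f' j j + y * F.f' (j - 1) j = 0) :
    t < j ∧ (j : ℝ) < t' := by
  have hW := F.rotating j j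
  have hj : 0 < F.f j j := F.pos _ _ le_rfl (by linarith)
  have hj' : 0 < F.f (j - 1) j := F.pos _ _ (by push_cast; linarith) (by push_cast; linarith)
  have h1 : 0 < F.f' j j := by
    by_contra! hc
    have : 0 ≤ F.f' (j - 1) j := by by_contra! hc'; nlinarith
    nlinarith
  have h2 : F.f' (j - 1) j < 0 := by by_contra! hc; nlinarith
  constructor
  · by_contra! hc
    rcases hc.eq_or_lt with e | hlt
    · rw [e, h.1] at h2; exact lt_irrefl _ h2
    · exact absurd (h.deriv_pos hlt fun r hr => h.pos_of_mem (by push_cast; linarith [hr.1]) hr.2)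
        (not_lt.2 h2.le)
  · by_contra! hc
    rcases hc.eq_or_lt with e | hlt
    · rw [← e, h'.1] at h1; exact lt_irrefl _ h1
    · exact absurd (h'.deriv_neg hlt fun r hr => h'.pos_of_mem' hr.1 (by linarith [hr.2]))
        (not_lt.2 h1.le)

end RotatingFamily

/-! ### The contact form and its Liouville class in coordinates -/

theorem dForm_apply {E : Type*} [NormedAddCommGroup E] [NormedSpace ℝ E] {β : E → E →L[ℝ] ℝ}
    {x : E} (h : DifferentiableAt ℝ β x) (v w : E) :
    dForm β x v w = fderiv ℝ (fun y => β y w) x v - fderiv ℝ (fun y => β y v) x w := by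
  have hd : DifferentiableAt ℝ
      (fun y => ContinuousAlternatingMap.ofSubsingleton ℝ E ℝ (0 : Fin 1) (β y)) x :=
    (ContinuousAlternatingMap.ofSubsingletonLIE (𝕜 := ℝ) (E := E) (F := ℝ)
      (0 : Fin 1)).differentiable.differentiableAt.comp x h
  rw [dForm, extDeriv_apply hd]
  simp [Fin.sum_univ_two, Fin.removeNth, sub_eq_add_neg]

namespace ContactBoundary

variable {m : ℕ} {C : PolarizedCycle m} (B : ContactBoundary C)

/-- The value of the Liouville class on the normal circle of `D_j`. The Liouville class has
coordinates `(coord j, coord (j - 1))` in the basis of the node `j`. -/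
noncomputable def coord (j : ℤ) (s : ℝ) : ℝ :=
  2 * Real.pi * Real.exp (B.u s) * (C.a j - B.ξ j s)

theorem contDiff_coord (j : ℤ) : ContDiff ℝ ∞ (B.coord j) :=
  (contDiff_const.mul B.u_smooth.exp).mul (contDiff_const.sub (B.smooth j))

theorem hasDerivAt_coord (j : ℤ) (s : ℝ) : HasDerivAt (B.coord j) (deriv (B.coord j) s) s :=
  ((B.contDiff_coord j).differentiable (by simp)).differentiableAt.hasDerivAt

theorem hasDerivAt_deriv_coord (j : ℤ) (s : ℝ) :
    HasDerivAt (deriv (B.coord j)) (deriv (deriv (B.coord j)) s) s := by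
  have h : ContDiff ℝ 1 (deriv (B.coord j)) :=
    ((contDiff_succ_iff_deriv (n := 1)).1 ((B.contDiff_coord j).of_le (by norm_cast))).2.2
  exact (h.differentiable (by simp)).differentiableAt.hasDerivAt

theorem coord_recurrence (j : ℤ) (s : ℝ) :
    B.coord (j - 1) s + C.k j * B.coord j s + B.coord (j + 1) s = 0 := by
  simp only [coord]
  linear_combination (-(2 * Real.pi * Real.exp (B.u s))) * B.transition j s

theorem coord_add_period (j : ℤ) (s : ℝ) : B.coord (j + m) (s + m) = B.coord j s := by
  simp [coord, B.u_periodic, B.closed_path]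

theorem coord_pos (j : ℤ) (s : ℝ) (h1 : (j : ℝ) ≤ s) (h2 : s ≤ j + 1) : 0 < B.coord j s :=
  mul_pos (by positivity) (sub_pos.2 (B.near j s h1 h2).2.1)

theorem α_apply (j : ℤ) (x v : (ℝ × ℝ) × ℝ) :
    B.α j x v = B.coord j x.2 * v.1.1 + B.coord (j - 1) x.2 * v.1.2 + B.h x.2 * v.2 := by
  have hξ : ∀ i, HasFDerivAt (fun y : (ℝ × ℝ) × ℝ => B.ξ i y.2)
      (fderiv ℝ (fun y : (ℝ × ℝ) × ℝ => B.ξ i y.2) x) x := fun i =>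
    (((B.smooth i).comp contDiff_snd).differentiable (by simp)).differentiableAt.hasFDerivAt
  have hi : HasFDerivAt (B.incl j) ((ContinuousLinearMap.fst ℝ (ℝ × ℝ) ℝ).prod
      ((fderiv ℝ (fun y : (ℝ × ℝ) × ℝ => B.ξ j y.2) x).prod
        (fderiv ℝ (fun y : (ℝ × ℝ) × ℝ => B.ξ (j - 1) y.2) x))) x :=
    hasFDerivAt_fst.prodMk ((hξ j).prodMk (hξ (j - 1)))
  simp only [α, ToricHypersurface.form, hi.fderiv, PolarizedCycle.toricLiouville]
  simp [ToricHypersurface.incl, coord]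
  ring

theorem hasFDerivAt_α_apply (j : ℤ) (x w : (ℝ × ℝ) × ℝ) :
    HasFDerivAt (fun y => B.α j y w)
      ((deriv (B.coord j) x.2 * w.1.1 + deriv (B.coord (j - 1)) x.2 * w.1.2 +
        deriv B.h x.2 * w.2) • ContinuousLinearMap.snd ℝ (ℝ × ℝ) ℝ) x := by
  have hh : HasDerivAt B.h (deriv B.h x.2) x.2 :=
    (B.h_smooth.differentiable (by simp)).differentiableAt.hasDerivAt
  have h1 := (((B.hasDerivAt_coord j x.2).mul_const w.1.1).add
    ((B.hasDerivAt_coord (j - 1) x.2).mul_const w.1.2)).add (hh.mul_const w.2)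
  have h2 := h1.comp_hasFDerivAt x (hasFDerivAt_snd (𝕜 := ℝ) (E := ℝ × ℝ) (F := ℝ) (p := x))
  refine h2.congr_of_eventuallyEq (Filter.Eventually.of_forall fun y => ?_)
  simp [α_apply]

theorem contDiff_α (j : ℤ) : ContDiff ℝ ∞ (B.α j) := by
  refine contDiff_clm_apply_iff.2 fun w => ?_
  have h := fun i => (B.contDiff_coord i).comp (contDiff_snd (𝕜 := ℝ) (E := ℝ × ℝ) (F := ℝ))
  have hh := B.h_smooth.comp (contDiff_snd (𝕜 := ℝ) (E := ℝ × ℝ) (F := ℝ))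
  simp only [α_apply]
  exact (((h j).mul contDiff_const).add ((h (j - 1)).mul contDiff_const)).add
    (hh.mul contDiff_const)

theorem differentiable_α (j : ℤ) : Differentiable ℝ (B.α j) :=
  (B.contDiff_α j).differentiable (by simp)

theorem dForm_α (j : ℤ) (x v w : (ℝ × ℝ) × ℝ) :
    dForm (B.α j) x v w =
      (deriv (B.coord j) x.2 * w.1.1 + deriv (B.coord (j - 1)) x.2 * w.1.2) * v.2 -
      (deriv (B.coord j) x.2 * v.1.1 + deriv (B.coord (j - 1)) x.2 * v.1.2) * w.2 := by
  rw [dForm_apply (B.differentiable_α j x), (B.hasFDerivAt_α_apply j x w).fderiv,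
    (B.hasFDerivAt_α_apply j x v).fderiv]
  simp
  ring

theorem dForm_cylForm (j : ℤ) (y v w : ((ℝ × ℝ) × ℝ) × ℝ) :
    dForm (B.cylForm j) y v w = Real.exp y.2 *
      (v.2 * B.α j y.1 w.1 - w.2 * B.α j y.1 v.1 + dForm (B.α j) y.1 v.1 w.1) := by
  have hf : ∀ w : ((ℝ × ℝ) × ℝ) × ℝ, HasFDerivAt (fun y => B.cylForm j y w)
      (Real.exp y.2 • ((fderiv ℝ (fun x => B.α j x w.1) y.1).comp
        (ContinuousLinearMap.fst ℝ ((ℝ × ℝ) × ℝ) ℝ)) +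
        (B.α j y.1 w.1) • (Real.exp y.2 • ContinuousLinearMap.snd ℝ ((ℝ × ℝ) × ℝ) ℝ)) y := fun w => by
    have h1 : HasFDerivAt (fun y : ((ℝ × ℝ) × ℝ) × ℝ => Real.exp y.2)
        (Real.exp y.2 • ContinuousLinearMap.snd ℝ ((ℝ × ℝ) × ℝ) ℝ) y :=
      (hasFDerivAt_snd (𝕜 := ℝ) (p := y)).exp
    have h2 := (B.hasFDerivAt_α_apply j y.1 w.1).differentiableAt.hasFDerivAt.comp y
      (hasFDerivAt_fst (𝕜 := ℝ) (p := y))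
    exact h1.mul h2
  have hd : DifferentiableAt ℝ (B.cylForm j) y := by
    have h1 : DifferentiableAt ℝ (fun y : ((ℝ × ℝ) × ℝ) × ℝ => Real.exp y.2) y := by fun_prop
    have h2 : DifferentiableAt ℝ (fun y : ((ℝ × ℝ) × ℝ) × ℝ => B.α j y.1) y :=
      (B.differentiable_α j y.1).comp y differentiableAt_fst
    exact h1.smul (h2.clm_comp (differentiableAt_const _))
  rw [dForm_apply hd, (hf v).fderiv, (hf w).fderiv, dForm_apply (B.differentiable_α j y.1)]
  simp
  ring

theorem A_eq (j : ℤ) : B.A j = fun s => B.coord j s • ContinuousLinearMap.fst ℝ ℝ ℝ +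
    B.coord (j - 1) s • ContinuousLinearMap.snd ℝ ℝ ℝ := by
  funext s
  ext <;>
  · have := B.α_apply j ((0, 0), s)
    simp only [A, ToricHypersurface.liouvilleClass]
    rw [α] at this
    simp [this]

theorem A_apply (j : ℤ) (s : ℝ) (v : ℝ × ℝ) :
    B.A j s v = v.1 * B.coord j s + v.2 * B.coord (j - 1) s := by
  simp [A_eq, mul_comm]

theorem deriv_A (j : ℤ) : deriv (B.A j) = fun s =>
    deriv (B.coord j) s • ContinuousLinearMap.fst ℝ ℝ ℝ +
    deriv (B.coord (j - 1)) s • ContinuousLinearMap.snd ℝ ℝ ℝ := by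
  funext s
  rw [A_eq]
  exact (((B.hasDerivAt_coord j s).smul_const _).add
    ((B.hasDerivAt_coord (j - 1) s).smul_const _)).deriv

theorem deriv_deriv_A (j : ℤ) : deriv (deriv (B.A j)) = fun s =>
    deriv (deriv (B.coord j)) s • ContinuousLinearMap.fst ℝ ℝ ℝ +
    deriv (deriv (B.coord (j - 1))) s • ContinuousLinearMap.snd ℝ ℝ ℝ := by
  funext s
  rw [deriv_A]
  exact (((B.hasDerivAt_deriv_coord j s).smul_const _).add
    ((B.hasDerivAt_deriv_coord (j - 1) s).smul_const _)).deriv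

theorem mem_reebLine {j : ℤ} {s : ℝ} {v : ℝ × ℝ} : v ∈ B.reebLine j s ↔
    v.1 * deriv (B.coord j) s + v.2 * deriv (B.coord (j - 1)) s = 0 := by
  simp [reebLine, deriv_A, mul_comm]

/-- This is the contact condition: `α ∧ dα` on the coordinate frame is the Wronskian. -/
theorem coord_rotating (j : ℤ) (s : ℝ) :
    0 < B.coord (j - 1) s * deriv (B.coord j) s - B.coord j s * deriv (B.coord (j - 1)) s := by
  have h := B.contact j ((0, 0), s)
  have h1 := B.α_apply j ((0, 0), s)
  have h2 := B.dForm_α j ((0, 0), s)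
  simp only [α] at h1 h2
  simp only [wedgeSelf, h1, h2] at h
  simp at h
  linarith

/-- The denominator of the convexity condition is negative by the contact condition, hence so is its
numerator. -/
theorem coord_convex (j : ℤ) (s : ℝ) :
    0 < deriv (B.coord (j - 1)) s * deriv (deriv (B.coord j)) s -
      deriv (B.coord j) s * deriv (deriv (B.coord (j - 1))) s := by
  have h : 0 < wedge (deriv (B.A j) s) (deriv (deriv (B.A j)) s) /
    wedge (B.A j s) (deriv (B.A j) s) := B.locally_convex j s
  have hW := B.coord_rotating j s
  rw [deriv_deriv_A, deriv_A, A_eq] at h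
  simp only [wedge] at h
  simp at h
  rcases div_pos_iff.1 h with h1 | h1 <;> linarith [h1.1, h1.2]

theorem coord_add_int_mul_period (j n : ℤ) (s : ℝ) :
    B.coord (j + n * m) (s + n * m) = B.coord j s := by
  induction n with
  | zero => simp
  | succ n ih =>
    have := B.coord_add_period (j + n * m) (s + n * m)
    push_cast at ih ⊢
    rw [← ih, ← this]; congr 1 <;> ring
  | pred n ih =>
    have := B.coord_add_period (j + (-n - 1) * m) (s + (-n - 1) * m)
    rw [← ih]; push_cast; rw [← this]; congr 1 <;> ring

theorem A_add_int_mul_period (j n : ℤ) (s : ℝ) : B.A (j + n * m) (s + n * m) = B.A j s := by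
  have h := B.coord_add_int_mul_period (j - 1) n s
  rw [show j - 1 + n * (m : ℤ) = j + n * m - 1 by ring] at h
  simp only [A_eq, coord_add_int_mul_period, h]

theorem reebLine_add_int_mul_period (j n : ℤ) (s : ℝ) :
    B.reebLine (j + n * m) (s + n * m) = B.reebLine j s := by
  have h : (fun s : ℝ => B.A (j + n * m) (s + n * m)) = B.A j :=
    funext (B.A_add_int_mul_period j n)
  have h1 := deriv_comp_add_const (f := B.A (j + n * m)) (n * m : ℝ) s
  rw [h] at h1
  rw [reebLine, reebLine, h1]

theorem A_glue (j : ℤ) (s : ℝ) (v : ℝ × ℝ) : B.A (j + 1) s (glue (C.k j) v) = B.A j s v := by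
  rw [A_apply, A_apply, add_sub_cancel_right, glue]
  linear_combination (-v.2) * B.coord_recurrence j s

theorem glue_mem_reebLine {j : ℤ} {s : ℝ} {v : ℝ × ℝ} :
    glue (C.k j) v ∈ B.reebLine (j + 1) s ↔ v ∈ B.reebLine j s := by
  have h : deriv (B.coord (j - 1)) s + C.k j * deriv (B.coord j) s + deriv (B.coord (j + 1)) s = 0 := by
    have h1 := ((B.hasDerivAt_coord (j - 1) s).add
      ((B.hasDerivAt_coord j s).const_mul (C.k j : ℝ))).add (B.hasDerivAt_coord (j + 1) s)
    refine h1.unique ((hasDerivAt_const s (0 : ℝ)).congr_of_eventuallyEq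
      (Filter.Eventually.of_forall fun r => ?_))
    exact B.coord_recurrence j r
  rw [mem_reebLine, mem_reebLine, add_sub_cancel_right, glue]
  constructor <;> intro h1
  · linear_combination h1 + v.2 * h
  · linear_combination h1 - v.2 * h

section Family

variable [NeZero m]

/-- The coordinates of the Liouville class form a rotating family. -/
noncomputable def family : RotatingFamily where
  f := B.coord
  f' j := deriv (B.coord j)
  f'' j := deriv (deriv (B.coord j))
  k j := C.k j
  a j := C.a j
  lo := C.a (Finite.exists_min C.a).choose
  hi := C.a (Finite.exists_max C.a).choose
  δ := (fun i => C.a (i - 1) + C.k i * C.a i + C.a (i + 1))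
    (Finite.exists_min (fun i => C.a (i - 1) + C.k i * C.a i + C.a (i + 1))).choose
  hasDeriv := B.hasDerivAt_coord
  hasDeriv' := B.hasDerivAt_deriv_coord
  lo_pos := C.a_pos _
  δ_pos := C.degree_pos _
  lo_le j := (Finite.exists_min C.a).choose_spec _
  le_hi j := (Finite.exists_max C.a).choose_spec _
  supersol j := by
    have := (Finite.exists_min
      (fun i => C.a (i - 1) + C.k i * C.a i + C.a (i + 1))).choose_spec j
    push_cast
    exact this
  recurrence := B.coord_recurrence
  pos := B.coord_pos
  rotating := B.coord_rotating
  convex := B.coord_convex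

/-- The point along `D_j` at which the Reeb direction is the one of the normal circle of `D_j`. -/
noncomputable def peak (j : ℤ) : ℝ := (B.family.exists_isPeak j).choose

theorem isPeak (j : ℤ) : B.family.IsPeak j (B.peak j) := (B.family.exists_isPeak j).choose_spec

theorem peak_lt (j : ℤ) : B.peak (j - 1) < B.peak j := (B.isPeak (j - 1)).lt (B.isPeak j)

theorem strictMono_peak : StrictMono B.peak := strictMono_int_of_lt_succ fun j => by
  have := B.peak_lt (j + 1)
  rwa [add_sub_cancel_right] at this

theorem peak_add_period (j : ℤ) : B.peak (j + m) = B.peak j + m := by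
  refine (B.isPeak (j + m)).unique ⟨?_, fun s hs => ?_⟩
  · have h : (fun s => B.coord (j + m) (s + m)) = B.coord j := funext (B.coord_add_period j)
    have h1 := deriv_comp_add_const (f := B.coord (j + m)) (m : ℝ) (B.peak j)
    rw [h] at h1
    exact h1.symm.trans (B.isPeak j).1
  · have h := B.coord_add_period j (s - m)
    rw [sub_add_cancel] at h
    change 0 < B.coord (j + m) s
    rw [h]
    refine (B.isPeak j).2 _ ?_
    push_cast at hs
    rw [Set.mem_uIcc] at hs ⊢
    rcases hs with h | h
    · left; constructor <;> linarith
    · right; constructor <;> linarith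

theorem peak_add_int_mul_period (j n : ℤ) : B.peak (j + n * m) = B.peak j + n * m := by
  induction n with
  | zero => simp
  | succ n ih =>
    have := B.peak_add_period (j + n * m)
    rw [show j + (n + 1 : ℤ) * m = j + n * m + m by ring, this, ih]; push_cast; ring
  | pred n ih =>
    have := B.peak_add_period (j + (-n - 1) * m)
    rw [show j + (-n - 1 : ℤ) * m + m = j + -n * m by ring, ih] at this
    push_cast at this ⊢; linarith

/-- The intervals between consecutive peaks cover the line. -/
theorem exists_mem_Icc_peak (s : ℝ) : ∃ j : ℤ, s ∈ Set.Icc (B.peak (j - 1)) (B.peak j) := by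
  have hm : (0 : ℝ) < m := by exact_mod_cast Nat.pos_of_ne_zero (NeZero.ne m)
  obtain ⟨n, hn⟩ := exists_int_lt ((s - B.peak 0) / m)
  obtain ⟨n', hn'⟩ := exists_int_gt ((s - B.peak 0) / m)
  rw [lt_div_iff₀ hm] at hn
  rw [div_lt_iff₀ hm] at hn'
  have h1 := B.peak_add_int_mul_period 0 n
  have h2 := B.peak_add_int_mul_period 0 n'
  rw [zero_add] at h1 h2
  obtain ⟨j, hj, hmax⟩ := Int.exists_greatest_of_bdd (P := fun j => B.peak j ≤ s)
    ⟨n' * m, fun z hz => (B.strictMono_peak.lt_iff_lt.1 (show B.peak z < B.peak (n' * m) by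
      linarith)).le⟩ ⟨n * m, by linarith⟩
  refine ⟨j + 1, by rwa [add_sub_cancel_right], ?_⟩
  by_contra! hc
  have := hmax _ hc.le
  omega

end Family

end ContactBoundary

/-! ### The torus bundle as a quotient of one chart -/

/-- The lattice `H_1 = ℤ × ℤ` in `H_1 ⊗ ℝ = ℝ × ℝ`. -/
def lattice : AddSubgroup (ℝ × ℝ) :=
  (Int.castAddHom ℝ).range.prod (Int.castAddHom ℝ).range

theorem mem_lattice {q : ℝ × ℝ} : q ∈ lattice ↔ ∃ a b : ℤ, q = ((a : ℝ), (b : ℝ)) := by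
  simp only [lattice, AddSubgroup.mem_prod, AddMonoidHom.mem_range, Int.coe_castAddHom]
  constructor
  · rintro ⟨⟨a, ha⟩, ⟨b, hb⟩⟩
    exact ⟨a, b, Prod.ext ha.symm hb.symm⟩
  · rintro ⟨a, b, rfl⟩
    exact ⟨⟨a, rfl⟩, ⟨b, rfl⟩⟩

theorem isClosed_lattice : IsClosed (lattice : Set (ℝ × ℝ)) :=
  Int.isClosedEmbedding_coe_real.isClosed_range.prod Int.isClosedEmbedding_coe_real.isClosed_range

/-- A line in the plane contained in the lattice is constant. -/
theorem eq_zero_of_line_mem_lattice {p w : ℝ × ℝ} (h : ∀ t : ℝ, p + t • w ∈ lattice) : w = 0 := by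
  have h1 : ∀ t : ℝ, t • w ∈ lattice := fun t => by
    have h2 := lattice.sub_mem (h t) (h 0)
    simpa using h2
  have h3 : ∀ x : ℝ, (∀ t : ℝ, ∃ a : ℤ, t * x = a) → x = 0 := fun x hx => by
    by_contra hne
    obtain ⟨a, ha⟩ := hx (1 / 2 / x)
    rw [div_mul_cancel₀ _ hne] at ha
    have : (2 * a : ℤ) = 1 := by
      have : (2 * a : ℝ) = 1 := by linarith
      exact_mod_cast this
    omega
  refine Prod.ext (h3 _ fun t => ?_) (h3 _ fun t => ?_)
  · obtain ⟨a, b, e⟩ := mem_lattice.1 (h1 t)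
    exact ⟨a, congrArg Prod.fst e⟩
  · obtain ⟨a, b, e⟩ := mem_lattice.1 (h1 t)
    exact ⟨b, congrArg Prod.snd e⟩

/-- The change of basis `glue n` as a linear automorphism. -/
def glueEquiv (n : ℤ) : (ℝ × ℝ) ≃ₗ[ℝ] (ℝ × ℝ) where
  toFun := glue n
  invFun w := (w.2 - n * w.1, -w.1)
  map_add' v w := by simp only [glue, Prod.mk_add_mk, Prod.fst_add, Prod.snd_add]; ext <;> ring
  map_smul' c v := by
    simp only [glue, Prod.smul_mk, Prod.smul_fst, Prod.smul_snd, smul_eq_mul, RingHom.id_apply]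
    refine Prod.ext ?_ ?_
    · simp
    · simp; ring
  left_inv v := by simp [glue]
  right_inv w := by simp [glue]

@[simp]
theorem glueEquiv_apply (n : ℤ) (v : ℝ × ℝ) : glueEquiv n v = glue n v := rfl

theorem glue_mem_lattice {n : ℤ} {v : ℝ × ℝ} : glue n v ∈ lattice ↔ v ∈ lattice := by
  rw [mem_lattice, mem_lattice]
  constructor
  · rintro ⟨a, b, h⟩
    refine ⟨b - n * a, -a, ?_⟩
    have h1 := congrArg Prod.fst h
    have h2 := congrArg Prod.snd h
    simp only [glue] at h1 h2
    refine Prod.ext ?_ ?_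
    · push_cast; linear_combination h2 - n * h1
    · push_cast; linear_combination -h1
  · rintro ⟨a, b, rfl⟩
    exact ⟨-b, a - n * b, by simp [glue]⟩

namespace PolarizedCycle

variable {m : ℕ} (C : PolarizedCycle m)

/-- Parallel transport from the basis of the node `n` to the basis of the node `0`. -/
def frameNat : ℕ → (ℝ × ℝ) ≃ₗ[ℝ] (ℝ × ℝ)
  | 0 => 1
  | n + 1 => frameNat n * (glueEquiv (C.k (n : ℤ)))⁻¹

/-- Parallel transport from the basis of the node `-n` to the basis of the node `0`. -/
def frameNeg : ℕ → (ℝ × ℝ) ≃ₗ[ℝ] (ℝ × ℝ)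
  | 0 => 1
  | n + 1 => frameNeg n * glueEquiv (C.k (Int.negSucc n))

/-- Parallel transport from the basis of the node `j` to the basis of the node `0`. -/
def frame : ℤ → (ℝ × ℝ) ≃ₗ[ℝ] (ℝ × ℝ)
  | Int.ofNat n => C.frameNat n
  | Int.negSucc n => C.frameNeg (n + 1)

theorem frame_zero : C.frame 0 = 1 := rfl

theorem frame_succ (j : ℤ) : C.frame (j + 1) * glueEquiv (C.k j) = C.frame j := by
  cases j with
  | ofNat n =>
    change C.frameNat n * (glueEquiv (C.k (n : ℤ)))⁻¹ * glueEquiv (C.k (n : ℤ)) = C.frameNat n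
    simp
  | negSucc n =>
    cases n with
    | zero => rfl
    | succ n => rfl

theorem frame_succ_apply (j : ℤ) (q : ℝ × ℝ) : C.frame (j + 1) (glue (C.k j) q) = C.frame j q :=
  congrArg (fun e : (ℝ × ℝ) ≃ₗ[ℝ] (ℝ × ℝ) => e q) (C.frame_succ j)

theorem frame_add_period (j : ℤ) : C.frame (j + m) = C.frame m * C.frame j := by
  have hk : ∀ i : ℤ, C.k (i + m : ℤ) = C.k i := fun i => by simp
  induction j with
  | zero => simp [frame_zero]
  | succ j ih =>
    have h1 := C.frame_succ (j + m)
    rw [hk, ih, ← C.frame_succ j, ← mul_assoc] at h1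
    rw [show (j + 1 + m : ℤ) = j + m + 1 by ring]
    exact mul_right_cancel h1
  | pred j ih =>
    have h1 := C.frame_succ (-j - 1 + m)
    have h2 := C.frame_succ (-j - 1)
    rw [hk, show (-j - 1 + m + 1 : ℤ) = -j + m by ring, ih] at h1
    rw [show (-j - 1 + 1 : ℤ) = -j by ring] at h2
    rw [← h1, ← h2, mul_assoc]

theorem frame_add_int_mul_period (j n : ℤ) : C.frame (j + n * m) = C.frame m ^ n * C.frame j := by
  induction n with
  | zero => simp
  | succ n ih =>
    rw [show (j + (n + 1) * m : ℤ) = j + n * m + m by ring, frame_add_period, ih, ← mul_assoc,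
      add_comm (n : ℤ), zpow_one_add]
  | pred n ih =>
    have h := C.frame_add_period (j + (-n - 1) * m)
    rw [show (j + (-n - 1) * m + m : ℤ) = j + -n * m by ring, ih] at h
    rw [zpow_sub_one, (Commute.zpow_self _ _).inv_right.eq, mul_assoc, h, inv_mul_cancel_left]

theorem frame_mem_lattice {j : ℤ} {q : ℝ × ℝ} : C.frame j q ∈ lattice ↔ q ∈ lattice := by
  induction j generalizing q with
  | zero => rw [frame_zero]; rfl
  | succ j ih =>
    obtain ⟨p, rfl⟩ := (glueEquiv (C.k (j : ℤ))).surjective q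
    rw [glueEquiv_apply, frame_succ_apply, ih, glue_mem_lattice]
  | pred j ih =>
    rw [← frame_succ_apply, show (-j - 1 + 1 : ℤ) = -j by ring, ih, glue_mem_lattice]

/-- The power `C.frame m ^ n` is the monodromy of the `n`-th deck transformation. -/
theorem monodromy_mem_lattice {n : ℤ} {q : ℝ × ℝ} :
    (C.frame m ^ n) q ∈ lattice ↔ q ∈ lattice := by
  have h := C.frame_add_int_mul_period 0 n
  rw [frame_zero, mul_one, zero_add] at h
  rw [← h, frame_mem_lattice]

/-- The equivalence relation generated by the identifications between the points of the charts: after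
transport to the basis of the node `0`, the points differ by a deck transformation and a lattice
vector. -/
def BdryEqv (x y : ℤ × (ℝ × ℝ) × ℝ) : Prop :=
  ∃ n : ℤ, y.2.2 = x.2.2 + n * m ∧
    C.frame y.1 y.2.1 - (C.frame m ^ n) (C.frame x.1 x.2.1) ∈ lattice

theorem bdryEqv_of_rel {x y : ℤ × (ℝ × ℝ) × ℝ} (h : BdryRel C x y) : C.BdryEqv x y := by
  cases h with
  | lattice j q s n₁ n₂ =>
    refine ⟨0, by simp, ?_⟩
    rw [zpow_zero, LinearEquiv.coe_one, id, ← map_sub, frame_mem_lattice, mem_lattice]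
    exact ⟨n₁, n₂, by ext <;> simp⟩
  | glue j q s =>
    refine ⟨0, by simp, ?_⟩
    rw [zpow_zero, LinearEquiv.coe_one, id, frame_succ_apply, sub_self]
    exact lattice.zero_mem
  | deck j q s =>
    refine ⟨1, by simp, ?_⟩
    rw [zpow_one, frame_add_period, LinearEquiv.mul_apply, sub_self]
    exact lattice.zero_mem

theorem bdryEqv_equivalence : Equivalence C.BdryEqv where
  refl x := ⟨0, by simp, by
    rw [zpow_zero, LinearEquiv.coe_one, id, sub_self]; exact lattice.zero_mem⟩
  symm := by
    rintro x y ⟨n, h1, h2⟩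
    refine ⟨-n, by rw [h1]; push_cast; ring, ?_⟩
    rw [← neg_mem_iff, ← C.monodromy_mem_lattice (n := n), neg_sub, map_sub,
      ← LinearEquiv.mul_apply, ← zpow_add, add_neg_cancel, zpow_zero, LinearEquiv.coe_one, id,
      ← neg_mem_iff, neg_sub, ← neg_mem_iff, neg_sub]
    exact h2
  trans := by
    rintro x y z ⟨n, h1, h2⟩ ⟨n', h1', h2'⟩
    refine ⟨n' + n, by rw [h1', h1]; push_cast; ring, ?_⟩
    rw [zpow_add, LinearEquiv.mul_apply]
    rw [← C.monodromy_mem_lattice (n := n'), map_sub] at h2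
    have := lattice.add_mem h2' h2
    rwa [sub_add_sub_cancel] at this

theorem chart_glue (j : ℤ) (q : ℝ × ℝ) (s : ℝ) :
    C.chart (j + 1) (LogCY.glue (C.k j) q, s) = C.chart j (q, s) :=
  (Quot.sound (BdryRel.glue j q s)).symm

theorem chart_frame (j : ℤ) (q : ℝ × ℝ) (s : ℝ) : C.chart 0 (C.frame j q, s) = C.chart j (q, s) := by
  induction j generalizing q with
  | zero => rw [frame_zero]; rfl
  | succ j ih =>
    obtain ⟨p, rfl⟩ := (glueEquiv (C.k (j : ℤ))).surjective q
    rw [glueEquiv_apply, frame_succ_apply, ih, chart_glue]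
  | pred j ih =>
    have h := C.chart_glue (-j - 1) q s
    rw [show (-j - 1 + 1 : ℤ) = -j by ring] at h
    rw [← frame_succ_apply, show (-j - 1 + 1 : ℤ) = -j by ring, ih, h]

theorem chart_deck (j n : ℤ) (q : ℝ × ℝ) (s : ℝ) :
    C.chart (j + n * m) (q, s + n * m) = C.chart j (q, s) := by
  induction n with
  | zero => simp
  | succ n ih =>
    have h : C.chart (j + n * m) (q, s + (n : ℤ) * m) =
      C.chart (j + n * m + m) (q, s + (n : ℤ) * m + m) := Quot.sound (BdryRel.deck _ _ _)
    rw [show j + ((n : ℤ) + 1) * m = j + n * m + m by ring,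
      show s + ((n + 1 : ℤ) : ℝ) * m = s + (n : ℤ) * m + m by push_cast; ring, ← h, ih]
  | pred n ih =>
    have h : C.chart (j + (-n - 1) * m) (q, s + (-n - 1 : ℤ) * m) =
      C.chart (j + (-n - 1) * m + m) (q, s + (-n - 1 : ℤ) * m + m) := Quot.sound (BdryRel.deck _ _ _)
    rw [h, ← ih, show j + (-(n : ℤ) - 1) * m + m = j + -n * m by ring,
      show s + ((-n - 1 : ℤ) : ℝ) * m + m = s + (-n : ℤ) * m by push_cast; ring]

theorem chart_add_lattice {j : ℤ} {q l : ℝ × ℝ} (hl : l ∈ lattice) (s : ℝ) :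
    C.chart j (q + l, s) = C.chart j (q, s) := by
  obtain ⟨a, b, rfl⟩ := mem_lattice.1 hl
  exact (Quot.sound (BdryRel.lattice j q s a b)).symm

theorem chart_eq_iff {j j' : ℤ} {q q' : ℝ × ℝ} {s s' : ℝ} :
    C.chart j (q, s) = C.chart j' (q', s') ↔ ∃ n : ℤ, s' = s + n * m ∧
      C.frame j' q' - (C.frame m ^ n) (C.frame j q) ∈ lattice := by
  constructor
  · intro h
    have h1 := Relation.EqvGen.mono (fun _ _ => C.bdryEqv_of_rel) _ _ (Quot.eqvGen_exact h)
    rw [C.bdryEqv_equivalence.eqvGen_eq] at h1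
    exact h1
  · rintro ⟨n, h1, h2⟩
    rw [← LinearEquiv.mul_apply, ← frame_add_int_mul_period] at h2
    rw [← C.chart_deck j n, ← h1, ← C.chart_frame (j + n * m), ← C.chart_frame j',
      ← C.chart_add_lattice h2, add_sub_cancel]

/-- Two points of one fibre agree exactly if they differ by the lattice. -/
theorem chart_eq_iff_sub_mem [NeZero m] {j : ℤ} {q q' : ℝ × ℝ} {s : ℝ} :
    C.chart j (q, s) = C.chart j (q', s) ↔ q' - q ∈ lattice := by
  rw [chart_eq_iff]
  constructor
  · rintro ⟨n, h1, h2⟩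
    have hm : (m : ℝ) ≠ 0 := by exact_mod_cast NeZero.ne m
    have hn : n = 0 := by
      have : (n : ℝ) * m = 0 := by linarith
      simpa [hm] using this
    rwa [hn, zpow_zero, LinearEquiv.coe_one, id, ← map_sub, frame_mem_lattice] at h2
  · intro h
    refine ⟨0, by simp, ?_⟩
    rwa [zpow_zero, LinearEquiv.coe_one, id, ← map_sub, frame_mem_lattice]

theorem continuous_chart (j : ℤ) : Continuous (C.chart j) :=
  (continuous_quot_mk (r := C.BdryRel)).comp (Continuous.prodMk_right j)

theorem continuous_linearEquiv (e : (ℝ × ℝ) ≃ₗ[ℝ] (ℝ × ℝ)) : Continuous e :=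
  e.toLinearMap.continuous_of_finiteDimensional

theorem isOpenQuotientMap_chart_zero : IsOpenQuotientMap (C.chart 0) := by
  refine ⟨fun x => ?_, C.continuous_chart 0, fun U hU => ?_⟩
  · induction x using Quot.ind with
    | mk x => exact ⟨(C.frame x.1 x.2.1, x.2.2), C.chart_frame _ _ _⟩
  · have h1 : ∀ (n : ℤ) (l : ℝ × ℝ), Continuous (fun x : ℤ × (ℝ × ℝ) × ℝ =>
        ((C.frame m ^ n) (C.frame x.1 x.2.1) + l, x.2.2 + n * m)) := fun n l => by
      rw [continuous_prod_of_discrete_left]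
      intro j
      exact (((continuous_linearEquiv _).comp ((continuous_linearEquiv (C.frame j)).comp
        continuous_fst)).add continuous_const).prodMk (continuous_snd.add continuous_const)
    -- the saturation of an open set is a union of its translates
    have h2 : Quot.mk C.BdryRel ⁻¹' (C.chart 0 '' U) = ⋃ (n : ℤ) (l : lattice),
        (fun x : ℤ × (ℝ × ℝ) × ℝ =>
          ((C.frame m ^ n) (C.frame x.1 x.2.1) + l, x.2.2 + n * m)) ⁻¹' U := by
      ext ⟨j, q, s⟩
      simp only [Set.mem_preimage, Set.mem_iUnion]
      constructor
      · rintro ⟨⟨q', s'⟩, hU', h⟩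
        obtain ⟨n, h3, h4⟩ := C.chart_eq_iff.1 (show C.chart j (q, s) = C.chart 0 (q', s') from h.symm)
        refine ⟨n, ⟨_, h4⟩, ?_⟩
        simpa [frame_zero, ← h3] using hU'
      · rintro ⟨n, l, h⟩
        refine ⟨_, h, ?_⟩
        refine (C.chart_eq_iff.2 ⟨n, rfl, ?_⟩ : C.chart j (q, s) = _).symm
        rw [frame_zero, LinearEquiv.coe_one, id, add_sub_cancel_left]
        exact l.2
    have h3 : IsOpen (Quot.mk C.BdryRel ⁻¹' (C.chart 0 '' U)) := by
      rw [h2]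
      exact isOpen_iUnion fun n => isOpen_iUnion fun l => hU.preimage (h1 n l)
    exact h3

instance t2Space_bdry [NeZero m] : T2Space C.Bdry := by
  rw [t2Space_iff_of_isOpenQuotientMap C.isOpenQuotientMap_chart_zero]
  have hm : (1 : ℝ) ≤ m := by exact_mod_cast Nat.one_le_iff_ne_zero.2 (NeZero.ne m)
  -- the relation is the union of the closed relations of the single deck transformations, which is
  -- locally finite as these translate the base coordinate by different multiples of `m`
  have h1 : {p : ((ℝ × ℝ) × ℝ) × ((ℝ × ℝ) × ℝ) | C.chart 0 p.1 = C.chart 0 p.2} =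
      ⋃ n : ℤ, {p | p.2.2 - p.1.2 ∈ ({(n * m : ℝ)} : Set ℝ)} ∩
        {p | p.2.1 - (C.frame m ^ n) p.1.1 ∈ (lattice : Set (ℝ × ℝ))} := by
    ext ⟨⟨q, s⟩, ⟨q', s'⟩⟩
    simp only [Set.mem_ofPred_eq, Set.mem_iUnion, Set.mem_inter_iff, chart_eq_iff, frame_zero,
      LinearEquiv.coe_one, id, Set.mem_singleton_iff, sub_eq_iff_eq_add']
    rfl
  rw [h1]
  have h2 : LocallyFinite (fun n : ℤ => ({(n * m : ℝ)} : Set ℝ)) := fun x => by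
    refine ⟨Metric.ball x 1, Metric.ball_mem_nhds x one_pos, ?_⟩
    refine (Set.finite_Icc (-⌈|x| + 1⌉) ⌈|x| + 1⌉).subset fun n hn => ?_
    obtain ⟨y, hy, hyx⟩ := hn
    rw [Set.mem_singleton_iff] at hy
    rw [Metric.mem_ball, Real.dist_eq, hy] at hyx
    have h3 : |(n : ℝ)| ≤ |x| + 1 := by
      have h4 : |(n : ℝ)| ≤ |(n : ℝ) * m| := by
        rw [abs_mul, Nat.abs_cast]
        exact le_mul_of_one_le_right (abs_nonneg _) hm
      have h5 := abs_sub_abs_le_abs_sub ((n : ℝ) * m) x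
      linarith
    have h6 := (abs_le.1 (h3.trans (Int.le_ceil _)))
    exact ⟨by exact_mod_cast h6.1, by exact_mod_cast h6.2⟩
  have hc : Continuous (fun p : ((ℝ × ℝ) × ℝ) × ((ℝ × ℝ) × ℝ) => p.2.2 - p.1.2) := by fun_prop
  refine LocallyFinite.isClosed_iUnion ((h2.preimage_continuous hc).subset fun n =>
    Set.inter_subset_left) fun n => ?_
  refine (isClosed_singleton.preimage hc).inter (isClosed_lattice.preimage ?_)
  exact (by fun_prop : Continuous (fun p : ((ℝ × ℝ) × ℝ) × ((ℝ × ℝ) × ℝ) => p.2.1)).sub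
    ((continuous_linearEquiv _).comp (by fun_prop))

end PolarizedCycle

/-! ### Reeb orbits and Hamiltonian orbits are linear -/

theorem hasDerivAt_fst_comp {E F : Type*} [NormedAddCommGroup E] [NormedSpace ℝ E]
    [NormedAddCommGroup F] [NormedSpace ℝ F] {c : ℝ → E × F} {R : E × F} {t : ℝ}
    (h : HasDerivAt c R t) : HasDerivAt (fun t => (c t).1) R.1 t :=
  (ContinuousLinearMap.fst ℝ E F).hasFDerivAt.comp_hasDerivAt t h

theorem hasDerivAt_snd_comp {E F : Type*} [NormedAddCommGroup E] [NormedSpace ℝ E]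
    [NormedAddCommGroup F] [NormedSpace ℝ F] {c : ℝ → E × F} {R : E × F} {t : ℝ}
    (h : HasDerivAt c R t) : HasDerivAt (fun t => (c t).2) R.2 t :=
  (ContinuousLinearMap.snd ℝ E F).hasFDerivAt.comp_hasDerivAt t h

theorem eq_add_smul_of_hasDerivAt {E : Type*} [NormedAddCommGroup E] [NormedSpace ℝ E] {c : ℝ → E}
    {R : E} (h : ∀ t, HasDerivAt c R t) (t : ℝ) : c t = c 0 + t • R := by
  have h1 : ∀ t, HasDerivAt (fun t => c t - t • R) 0 t := fun t => by
    have := (h t).sub ((hasDerivAt_id t).smul_const R)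
    exact this.congr_deriv (by simp)
  have h2 := is_const_of_deriv_eq_zero (fun t => (h1 t).differentiableAt) (fun t => (h1 t).deriv) t 0
  simp only [zero_smul, sub_zero] at h2
  rw [← h2, sub_add_cancel]

namespace ContactBoundary

variable {m : ℕ} {C : PolarizedCycle m} (B : ContactBoundary C)

/-- The Liouville class and its derivative are linearly independent. -/
theorem eq_zero_of_coord {j : ℤ} {s x y : ℝ} (h : x * B.coord j s + y * B.coord (j - 1) s = 0)
    (h' : x * deriv (B.coord j) s + y * deriv (B.coord (j - 1)) s = 0) : x = 0 ∧ y = 0 := by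
  have hW := (B.coord_rotating j s).ne'
  constructor
  · refine (mul_eq_zero.1 (?_ : x * _ = 0)).resolve_right hW
    linear_combination B.coord (j - 1) s * h' - deriv (B.coord (j - 1)) s * h
  · refine (mul_eq_zero.1 (?_ : y * _ = 0)).resolve_right hW
    linear_combination deriv (B.coord j) s * h - B.coord j s * h'

theorem eq_zero_of_coord' {j : ℤ} {s x y : ℝ} (h : x * B.coord j s + y * deriv (B.coord j) s = 0)
    (h' : x * B.coord (j - 1) s + y * deriv (B.coord (j - 1)) s = 0) : x = 0 ∧ y = 0 := by
  have hW := (B.coord_rotating j s).ne'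
  constructor
  · refine (mul_eq_zero.1 (?_ : x * _ = 0)).resolve_right hW
    linear_combination deriv (B.coord j) s * h' - deriv (B.coord (j - 1)) s * h
  · refine (mul_eq_zero.1 (?_ : y * _ = 0)).resolve_right hW
    linear_combination B.coord (j - 1) s * h - B.coord j s * h'

theorem eq_of_mem_reebLine {j : ℤ} {s : ℝ} {v w : ℝ × ℝ} (hv : v ∈ B.reebLine j s)
    (hw : w ∈ B.reebLine j s) (h : B.A j s v = B.A j s w) : v = w := by
  rw [mem_reebLine] at hv hw
  rw [A_apply, A_apply] at h
  have := B.eq_zero_of_coord (j := j) (s := s) (x := v.1 - w.1) (y := v.2 - w.2)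
    (by linear_combination h) (by linear_combination hv - hw)
  exact Prod.ext (sub_eq_zero.1 this.1) (sub_eq_zero.1 this.2)

/-- The Reeb vector field is tangent to the fibres, where it is the normalised vector in the
annihilator of the derivative of the Liouville class. -/
theorem reeb_iff {j : ℤ} {x R : (ℝ × ℝ) × ℝ} :
    (B.α j x R = 1 ∧ ∀ v, dForm (B.α j) x R v = 0) ↔
      R.2 = 0 ∧ R.1 ∈ B.reebLine j x.2 ∧ B.A j x.2 R.1 = 1 := by
  simp only [dForm_α, α_apply, mem_reebLine, A_apply]
  constructor
  · rintro ⟨h1, h2⟩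
    -- the torus directions show that `R` is vertical, the base direction gives its line
    have e1 := h2 ((1, 0), 0)
    have e2 := h2 ((0, 1), 0)
    have e3 := h2 ((0, 0), 1)
    simp only [mul_one, mul_zero, add_zero, zero_add, sub_zero, zero_mul, zero_sub] at e1 e2 e3
    have hR := (B.eq_zero_of_coord' (j := j) (s := x.2) (x := 0) (y := R.2)
      (by linear_combination e1) (by linear_combination e2)).2
    refine ⟨hR, by linear_combination -e3, ?_⟩
    rw [hR] at h1
    linear_combination h1
  · rintro ⟨h1, h2, h3⟩
    refine ⟨by rw [h1]; linear_combination h3, fun v => ?_⟩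
    rw [h1]
    linear_combination (-v.2) * h2

/-- The Hamiltonian vector field is `e^ρ` times the Reeb vector field. -/
theorem ham_iff {j : ℤ} {y X : ((ℝ × ℝ) × ℝ) × ℝ} :
    (∀ v, dForm (B.cylForm j) y v X = fderiv ℝ ham y v) ↔
      X.2 = 0 ∧ X.1.2 = 0 ∧ X.1.1 ∈ B.reebLine j y.1.2 ∧
        B.A j y.1.2 X.1.1 = Real.exp y.2 := by
  have hH : ∀ v, fderiv ℝ ham y v = Real.exp y.2 * (Real.exp y.2 * v.2) := fun v => by
    have h1 : HasFDerivAt ham ((2 * Real.exp y.2 ^ 1 / 2) •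
        (Real.exp y.2 • ContinuousLinearMap.snd ℝ ((ℝ × ℝ) × ℝ) ℝ)) y := by
      have h2 : HasDerivAt (fun r : ℝ => r ^ 2 / 2) (2 * Real.exp y.2 ^ 1 / 2) (Real.exp y.2) := by
        simpa using (hasDerivAt_pow 2 (Real.exp y.2)).div_const 2
      exact h2.comp_hasFDerivAt y (hasFDerivAt_snd (𝕜 := ℝ) (p := y)).exp
    rw [h1.fderiv]
    simp
  have hexp := (Real.exp_pos y.2).ne'
  simp only [dForm_cylForm, hH, mul_right_inj' hexp, dForm_α, α_apply, mem_reebLine, A_apply]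
  constructor
  · intro h
    -- the torus directions show that `ρ` and `s` are constant, the base direction gives the line of
    -- the field, and the direction of `ρ` its length
    have e1 := h (((1, 0), 0), 0)
    have e2 := h (((0, 1), 0), 0)
    have e3 := h (((0, 0), 1), 0)
    have e4 := h (((0, 0), 0), 1)
    simp only [mul_one, mul_zero, add_zero, zero_add, sub_zero, zero_mul, zero_sub, one_mul]
      at e1 e2 e3 e4
    obtain ⟨h1, h2⟩ := B.eq_zero_of_coord' (j := j) (s := y.1.2) (x := X.2) (y := X.1.2)
      (by linear_combination -e1) (by linear_combination -e2)
    rw [h1] at e3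
    rw [h2] at e4
    exact ⟨h1, h2, by linear_combination e3, by linear_combination e4⟩
  · rintro ⟨h1, h2, h3, h4⟩ v
    rw [h1, h2]
    linear_combination v.2 * h4 + v.1.2 * h3

theorem isReebCurve_iff {j : ℤ} {c : ℝ → (ℝ × ℝ) × ℝ} : B.IsReebCurve j c ↔
    ∃ (q v : ℝ × ℝ) (s : ℝ), v ∈ B.reebLine j s ∧ B.A j s v = 1 ∧
      c = fun t => (q + t • v, s) := by
  constructor
  · intro h
    choose R hR h1 h2 using h
    have h3 := fun t => B.reeb_iff.1 ⟨h1 t, h2 t⟩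
    have hs : ∀ t, (c t).2 = (c 0).2 := fun t => by
      have h4 : ∀ t, HasDerivAt (fun t => (c t).2) 0 t := fun t =>
        (h3 t).1 ▸ hasDerivAt_snd_comp (hR t)
      simpa using eq_add_smul_of_hasDerivAt h4 t
    have hR0 : ∀ t, R t = R 0 := fun t => by
      refine Prod.ext ?_ ((h3 t).1.trans (h3 0).1.symm)
      have h5 := (h3 t).2
      rw [hs t] at h5
      exact B.eq_of_mem_reebLine h5.1 (h3 0).2.1 (h5.2.trans (h3 0).2.2.symm)
    refine ⟨(c 0).1, (R 0).1, (c 0).2, (h3 0).2.1, (h3 0).2.2, funext fun t => ?_⟩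
    rw [eq_add_smul_of_hasDerivAt (c := c) (fun t => hR0 t ▸ hR t) t]
    exact Prod.ext rfl (by simp [(h3 0).1])
  · rintro ⟨q, v, s, hv, h1, rfl⟩ t
    refine ⟨(v, 0), ?_, B.reeb_iff.2 ⟨rfl, hv, h1⟩⟩
    have h2 : HasDerivAt (fun t : ℝ => q + t • v) v t := by
      simpa using ((hasDerivAt_id t).smul_const v).const_add q
    exact h2.prodMk (hasDerivAt_const t s)

theorem isHamCurve_iff {j : ℤ} {c : ℝ → ((ℝ × ℝ) × ℝ) × ℝ} : B.IsHamCurve j c ↔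
    ∃ (q v : ℝ × ℝ) (s ρ : ℝ), v ∈ B.reebLine j s ∧ B.A j s v = Real.exp ρ ∧
      c = fun t => ((q + t • v, s), ρ) := by
  constructor
  · intro h
    choose R hR h2 using h
    have h3 := fun t => B.ham_iff.1 (h2 t)
    have hρ : ∀ t, (c t).2 = (c 0).2 := fun t => by
      have h4 : ∀ t, HasDerivAt (fun t => (c t).2) 0 t := fun t =>
        (h3 t).1 ▸ hasDerivAt_snd_comp (hR t)
      simpa using eq_add_smul_of_hasDerivAt h4 t
    have hR1 : ∀ t, HasDerivAt (fun t => (c t).1) (R t).1 t := fun t =>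
      hasDerivAt_fst_comp (hR t)
    have hs : ∀ t, (c t).1.2 = (c 0).1.2 := fun t => by
      have h4 : ∀ t, HasDerivAt (fun t => (c t).1.2) 0 t := fun t =>
        (h3 t).2.1 ▸ hasDerivAt_snd_comp (hR1 t)
      simpa using eq_add_smul_of_hasDerivAt h4 t
    have hR0 : ∀ t, R t = R 0 := fun t => by
      refine Prod.ext (Prod.ext ?_ ((h3 t).2.1.trans (h3 0).2.1.symm))
        ((h3 t).1.trans (h3 0).1.symm)
      have h5 := (h3 t).2.2
      rw [hs t, hρ t] at h5
      exact B.eq_of_mem_reebLine h5.1 (h3 0).2.2.1 (h5.2.trans (h3 0).2.2.2.symm)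
    refine ⟨(c 0).1.1, (R 0).1.1, (c 0).1.2, (c 0).2, (h3 0).2.2.1, (h3 0).2.2.2,
      funext fun t => ?_⟩
    rw [eq_add_smul_of_hasDerivAt (c := c) (fun t => hR0 t ▸ hR t) t]
    exact Prod.ext (Prod.ext rfl (by simp [(h3 0).2.1])) (by simp [(h3 0).1])
  · rintro ⟨q, v, s, ρ, hv, h1, rfl⟩ t
    refine ⟨((v, 0), 0), ?_, B.ham_iff.2 ⟨rfl, rfl, hv, h1⟩⟩
    have h2 : HasDerivAt (fun t : ℝ => q + t • v) v t := by
      simpa using ((hasDerivAt_id t).smul_const v).const_add q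
    exact (h2.prodMk (hasDerivAt_const t s)).prodMk (hasDerivAt_const t ρ)

/-- The periods of the closed Reeb orbits are the values of the Liouville class on the integral
vectors in the annihilators of its derivative. -/
theorem isReebPeriod_iff [NeZero m] {T : ℝ} : B.IsReebPeriod T ↔ 0 < T ∧
    ∃ (j : ℤ) (s : ℝ) (v : ℝ × ℝ), v ∈ lattice ∧ v ∈ B.reebLine j s ∧ B.A j s v = T := by
  refine and_congr_right fun hT => ⟨?_, ?_⟩
  · rintro ⟨j, c, hc, hp⟩
    obtain ⟨q, v, s, hv, h1, rfl⟩ := B.isReebCurve_iff.1 hc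
    refine ⟨j, s, T • v, ?_, (B.reebLine j s).smul_mem T hv, by simp [h1]⟩
    have h2 := C.chart_eq_iff_sub_mem.1 (hp 0).symm
    simpa using h2
  · rintro ⟨j, s, v, hl, hv, h1⟩
    refine ⟨j, fun t => (0 + t • (T⁻¹ • v), s), B.isReebCurve_iff.2
      ⟨0, T⁻¹ • v, s, (B.reebLine j s).smul_mem _ hv, by simp [h1, hT.ne'], rfl⟩, fun t => ?_⟩
    refine (C.chart_eq_iff_sub_mem.2 ?_).symm
    rw [zero_add, zero_add, ← sub_smul, add_sub_cancel_left, smul_smul, mul_inv_cancel₀ hT.ne',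
      one_smul]
    exact hl

/-! ### Linear loops and the integral points of the cones -/

theorem A_frame (j : ℤ) (s : ℝ) (v : ℝ × ℝ) : B.A 0 s (C.frame j v) = B.A j s v := by
  induction j generalizing v with
  | zero => rfl
  | succ j ih =>
    obtain ⟨p, rfl⟩ := (glueEquiv (C.k (j : ℤ))).surjective v
    rw [glueEquiv_apply, C.frame_succ_apply, ih, A_glue]
  | pred j ih =>
    have h := B.A_glue (-j - 1) s v
    rw [show (-j - 1 + 1 : ℤ) = -j by ring] at h
    rw [← C.frame_succ_apply, show (-j - 1 + 1 : ℤ) = -j by ring, ih, h]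

theorem frame_mem_reebLine {j : ℤ} {s : ℝ} {v : ℝ × ℝ} :
    C.frame j v ∈ B.reebLine 0 s ↔ v ∈ B.reebLine j s := by
  induction j generalizing v with
  | zero => rfl
  | succ j ih =>
    obtain ⟨p, rfl⟩ := (glueEquiv (C.k (j : ℤ))).surjective v
    rw [glueEquiv_apply, C.frame_succ_apply, ih, glue_mem_reebLine]
  | pred j ih =>
    have h := B.glue_mem_reebLine (j := -j - 1) (s := s) (v := v)
    rw [show (-j - 1 + 1 : ℤ) = -j by ring] at h
    rw [← C.frame_succ_apply, show (-j - 1 + 1 : ℤ) = -j by ring, ih, h]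

theorem linearLoops_frame (j : ℤ) (v : ℝ × ℝ) (s : ℝ) :
    B.linearLoops 0 (C.frame j v) s = B.linearLoops j v s := by
  ext γ
  constructor
  · rintro ⟨q, hq⟩
    obtain ⟨p, rfl⟩ := (C.frame j).surjective q
    refine ⟨p, fun t => ?_⟩
    rw [hq, ← map_smul, ← map_add, C.chart_frame, A_frame]
  · rintro ⟨q, hq⟩
    refine ⟨C.frame j q, fun t => ?_⟩
    rw [hq, ← map_smul, ← map_add, C.chart_frame, A_frame]

theorem linearLoops_glue (j : ℤ) (v : ℝ × ℝ) (s : ℝ) :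
    B.linearLoops (j + 1) (glue (C.k j) v) s = B.linearLoops j v s := by
  rw [← linearLoops_frame, C.frame_succ_apply, linearLoops_frame]

theorem linearLoops_deck (j n : ℤ) (v : ℝ × ℝ) (s : ℝ) :
    B.linearLoops (j + n * m) v (s + n * m) = B.linearLoops j v s := by
  ext γ
  simp only [linearLoops, C.chart_deck, A_add_int_mul_period]

theorem value_of_linearLoops {j : ℤ} {v : ℝ × ℝ} {s : ℝ}
    {γ : C(UnitAddCircle, C.Bdry × ℝ)} (h : γ ∈ B.linearLoops j v s) :
    (γ 0).2 = Real.log (B.A j s v) := by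
  obtain ⟨q, hq⟩ := h
  have := hq 0
  rw [AddCircle.coe_zero] at this
  rw [this]

section Peaks

variable [NeZero m]

/-- An integral vector in the annihilator of the derivative of the Liouville class, on which this
class is positive, lies in the cone `Q_i` whose interval contains the base point. -/
theorem exists_cone {j : ℤ} {s : ℝ} {v : ℝ × ℝ} (hl : v ∈ lattice) (hv : v ∈ B.reebLine j s)
    (hA : 0 < B.A j s v) : ∃ i : ℤ, s ∈ Set.Icc (B.peak (i - 1)) (B.peak i) ∧ ∃ a b : ℕ,
      (a, b) ≠ (0, 0) ∧ ((a : ℝ), (b : ℝ)) ∈ B.reebLine i s ∧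
      C.frame i ((a : ℝ), (b : ℝ)) = C.frame j v := by
  obtain ⟨i, hi⟩ := B.exists_mem_Icc_peak s
  obtain ⟨w, hw⟩ := (C.frame i).surjective (C.frame j v)
  rw [← C.frame_mem_lattice (j := j), ← hw, C.frame_mem_lattice, mem_lattice] at hl
  rw [← frame_mem_reebLine, ← hw, frame_mem_reebLine] at hv
  rw [← A_frame, ← hw, A_frame] at hA
  obtain ⟨x, y, rfl⟩ := hl
  have hv' := B.mem_reebLine.1 hv
  rw [A_apply] at hA
  simp only at hv' hA
  have hd : 0 < deriv (B.coord i) s - deriv (B.coord (i - 1)) s :=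
    (B.isPeak (i - 1)).deriv_sub_pos (B.isPeak i) hi.1 hi.2
  have h1 : (x * B.coord i s + y * B.coord (i - 1) s) *
      (deriv (B.coord i) s - deriv (B.coord (i - 1)) s) = (x + y) * (B.coord (i - 1) s *
      deriv (B.coord i) s - B.coord i s * deriv (B.coord (i - 1)) s) :=
    RotatingFamily.value_of_deriv_eq_zero (F := B.family) hv'
  have hxy : (0 : ℝ) < x + y :=
    pos_of_mul_pos_left (h1 ▸ mul_pos hA hd) (B.coord_rotating i s).le
  have hf : 0 ≤ deriv (B.coord i) s := by
    rcases hi.2.eq_or_lt with e | h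
    · rw [e]; exact (B.isPeak i).1.ge
    · exact ((B.isPeak (i - 1)).deriv_pos_between (B.isPeak i) hi.1 h).le
  have hg : deriv (B.coord (i - 1)) s ≤ 0 := by
    rcases hi.1.eq_or_lt with e | h
    · rw [← e]; exact (B.isPeak (i - 1)).1.le
    · exact ((B.isPeak (i - 1)).deriv_neg_between (B.isPeak i) h hi.2).le
  have hx : (0 : ℝ) ≤ x := by by_contra! hc; nlinarith
  have hy : (0 : ℝ) ≤ y := by by_contra! hc; nlinarith
  have hx' : 0 ≤ x := by exact_mod_cast hx
  have hy' : 0 ≤ y := by exact_mod_cast hy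
  lift x to ℕ using hx'
  lift y to ℕ using hy'
  refine ⟨i, hi, x, y, ?_, by simpa using hv, by simpa using hw⟩
  rintro h
  rw [Prod.mk.injEq] at h
  simp [h.1, h.2] at hxy

theorem one_le_natCast_add {a b : ℕ} (h : (a, b) ≠ (0, 0)) : (1 : ℝ) ≤ a + b := by
  have : 1 ≤ a + b := by
    by_contra! hc
    exact h (Prod.ext (show a = 0 by omega) (show b = 0 by omega))
  exact_mod_cast this

theorem existsUnique_base (j : ℤ) {a b : ℕ} (h : (a, b) ≠ (0, 0)) :
    ∃! s, s ∈ Set.Icc (B.peak (j - 1)) (B.peak j) ∧ ((a : ℝ), (b : ℝ)) ∈ B.reebLine j s := by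
  simp only [mem_reebLine]
  exact (B.isPeak (j - 1)).existsUnique (B.isPeak j) a.cast_nonneg b.cast_nonneg
    (one_pos.trans_le (one_le_natCast_add h))

theorem A_pos_of_mem {j : ℤ} {a b : ℕ} (h : (a, b) ≠ (0, 0)) {s : ℝ}
    (hs : s ∈ Set.Icc (B.peak (j - 1)) (B.peak j)) (hv : ((a : ℝ), (b : ℝ)) ∈ B.reebLine j s) :
    0 < B.A j s ((a : ℝ), (b : ℝ)) := by
  rw [A_apply]
  exact (B.isPeak (j - 1)).value_pos (B.isPeak j) hs.1 hs.2
    (one_pos.trans_le (one_le_natCast_add h)) (B.mem_reebLine.1 hv)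

/-- The period in the class `v` grows at least linearly with `v`. -/
theorem exists_linear_lower_bound : ∃ c : ℝ, 0 < c ∧ ∀ (j : ℤ) (s x y : ℝ),
    s ∈ Set.Icc (B.peak (j - 1)) (B.peak j) → 0 ≤ x + y → (x, y) ∈ B.reebLine j s →
      c * (x + y) ≤ B.A j s (x, y) := by
  have h1 : ∀ j : ℤ, ∃ c : ℝ, 0 < c ∧ ∀ s x y : ℝ,
      s ∈ Set.Icc (B.peak (j - 1)) (B.peak j) → 0 ≤ x + y → (x, y) ∈ B.reebLine j s →
      c * (x + y) ≤ B.A j s (x, y) := fun j => by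
    -- on the interval of the cone, the period in the class `(x, y)` is `(x + y) * W / d`
    set W : ℝ → ℝ := fun s => B.coord (j - 1) s * deriv (B.coord j) s -
      B.coord j s * deriv (B.coord (j - 1)) s with hW
    set d : ℝ → ℝ := fun s => deriv (B.coord j) s - deriv (B.coord (j - 1)) s with hd
    have hdpos : ∀ s ∈ Set.Icc (B.peak (j - 1)) (B.peak j), 0 < d s := fun s hs =>
      (B.isPeak (j - 1)).deriv_sub_pos (B.isPeak j) hs.1 hs.2
    have hc : ∀ i, Continuous (B.coord i) := fun i => (B.contDiff_coord i).continuous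
    have hc' : ∀ i, Continuous (deriv (B.coord i)) := fun i =>
      continuous_iff_continuousAt.2 fun s => (B.hasDerivAt_deriv_coord i s).continuousAt
    have hcont : ContinuousOn (fun s => W s / d s) (Set.Icc (B.peak (j - 1)) (B.peak j)) :=
      (((hc _).mul (hc' _)).sub ((hc _).mul (hc' _))).continuousOn.div
        ((hc' _).sub (hc' _)).continuousOn fun s hs => (hdpos s hs).ne'
    obtain ⟨r, hr, hmin⟩ := isCompact_Icc.exists_isMinOn
      (Set.nonempty_Icc.2 (B.peak_lt j).le) hcont
    refine ⟨W r / d r, div_pos (B.coord_rotating j r) (hdpos r hr), fun s x y hs hxy hv => ?_⟩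
    have h2 : B.A j s (x, y) * d s = (x + y) * W s := by
      rw [A_apply]
      exact RotatingFamily.value_of_deriv_eq_zero (F := B.family) (B.mem_reebLine.1 hv)
    have h3 : B.A j s (x, y) = W s / d s * (x + y) := by
      have := (hdpos s hs).ne'
      field_simp
      linear_combination h2
    rw [h3]
    exact mul_le_mul_of_nonneg_right (hmin hs) hxy
  -- the deck transformations reduce the bounds to finitely many cones
  choose c hc0 hc using h1
  obtain ⟨i₀, hi₀⟩ := Finite.exists_min (fun i : Fin m => c (i : ℕ))
  refine ⟨c (i₀ : ℕ), hc0 _, fun j s x y hs hxy hv => ?_⟩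
  have hm : (0 : ℤ) < m := by exact_mod_cast Nat.pos_of_ne_zero (NeZero.ne m)
  have e := Int.emod_add_ediv_mul j m
  have hj0 := Int.emod_nonneg j hm.ne'
  have hjm := Int.emod_lt_of_pos j hm
  set n := j / (m : ℤ)
  obtain ⟨i, hi⟩ := Int.eq_ofNat_of_zero_le hj0
  rw [hi] at e hjm
  have him : i < m := by exact_mod_cast hjm
  have es : s = (s - n * m) + n * m := by ring
  have hs' : s - n * m ∈ Set.Icc (B.peak ((i : ℤ) - 1)) (B.peak i) := by
    have p1 := B.peak_add_int_mul_period (i - 1) n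
    have p2 := B.peak_add_int_mul_period i n
    rw [show (i : ℤ) - 1 + n * m = j - 1 by rw [← e]; ring] at p1
    rw [e] at p2
    exact ⟨by linarith [hs.1], by linarith [hs.2]⟩
  rw [← e, es, B.reebLine_add_int_mul_period] at hv
  have h2 := hc i (s - n * m) x y hs' hxy hv
  rw [← B.A_add_int_mul_period _ n, ← es, e] at h2
  exact (mul_le_mul_of_nonneg_right (hi₀ ⟨i, him⟩) hxy).trans h2

theorem exists_period_bound : ∃ ρ₀ : ℝ, ∀ T, B.IsReebPeriod T → Real.exp ρ₀ ≤ T := by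
  obtain ⟨c, hc, h⟩ := B.exists_linear_lower_bound
  refine ⟨Real.log c, fun T hT => ?_⟩
  rw [Real.exp_log hc]
  obtain ⟨hT0, j, s, v, hl, hv, rfl⟩ := B.isReebPeriod_iff.1 hT
  obtain ⟨i, hi, a, b, hab, hv', hf⟩ := B.exists_cone hl hv hT0
  have h1 := one_le_natCast_add hab
  have h2 := h i s a b hi (by linarith) hv'
  rw [← A_frame, hf, A_frame] at h2
  exact (le_mul_of_one_le_right hc.le h1).trans h2

/-- The one-periodic orbits in the end are the linear loops in the classes of the nonzero integral
points of the cones. -/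
theorem mem_orbits_iff {ρ₀ : ℝ} (hρ : ∀ T, B.IsReebPeriod T → Real.exp ρ₀ ≤ T)
    {γ : C(UnitAddCircle, C.Bdry × ℝ)} : γ ∈ B.orbits ρ₀ ↔ ∃ (i : ℤ) (s : ℝ) (a b : ℕ),
      (a, b) ≠ (0, 0) ∧ s ∈ Set.Icc (B.peak (i - 1)) (B.peak i) ∧
      ((a : ℝ), (b : ℝ)) ∈ B.reebLine i s ∧ γ ∈ B.linearLoops i ((a : ℝ), (b : ℝ)) s := by
  constructor
  · rintro ⟨⟨j, c, hc, hγ⟩, -⟩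
    obtain ⟨q, v, s, ρ, hv, h1, rfl⟩ := B.isHamCurve_iff.1 hc
    -- the loop closes up after time one, so its direction is integral
    have hl : v ∈ lattice := by
      have h2 := (hγ 0).symm.trans ((congrArg γ
        (by rw [AddCircle.coe_zero, AddCircle.coe_period] :
          ((0 : ℝ) : UnitAddCircle) = ((1 : ℝ) : UnitAddCircle))).trans (hγ 1))
      have h3 := C.chart_eq_iff_sub_mem.1 (congrArg Prod.fst h2)
      simpa using h3
    have hlin : γ ∈ B.linearLoops j v s := ⟨q, fun t => by rw [hγ, h1, Real.log_exp]⟩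
    obtain ⟨i, hi, a, b, hab, hv', hf⟩ := B.exists_cone hl hv (h1 ▸ Real.exp_pos ρ)
    refine ⟨i, s, a, b, hab, hi, hv', ?_⟩
    rwa [← linearLoops_frame, hf, linearLoops_frame]
  · rintro ⟨i, s, a, b, hab, hi, hv, q, hq⟩
    have hpos := B.A_pos_of_mem hab hi hv
    have hT : B.IsReebPeriod (B.A i s ((a : ℝ), (b : ℝ))) := B.isReebPeriod_iff.2
      ⟨hpos, i, s, _, mem_lattice.2 ⟨a, b, by simp⟩, hv, rfl⟩
    refine ⟨⟨i, _, B.isHamCurve_iff.2 ⟨q, _, s, Real.log (B.A i s ((a : ℝ), (b : ℝ))), hv,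
      (Real.exp_log hpos).symm, rfl⟩, hq⟩, fun t => ?_⟩
    obtain ⟨r, rfl⟩ := QuotientAddGroup.mk_surjective t
    have h1 := hq r
    change ρ₀ ≤ (γ (r : UnitAddCircle)).2
    rw [h1]
    exact (Real.le_log_iff_exp_le hpos).2 (hρ _ hT)

end Peaks

end ContactBoundary

/-! ### Tori of linear loops -/

/-- The projection of `H_1 ⊗ ℝ` to the torus `(H_1 ⊗ ℝ) / H_1`. -/
noncomputable def torusMk (q : ℝ × ℝ) : UnitAddTorus (Fin 2) :=
  fun i => ((Homeomorph.piFinTwo fun _ => ℝ).symm q i : UnitAddCircle)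

theorem isOpenQuotientMap_torusMk : IsOpenQuotientMap torusMk :=
  (IsOpenQuotientMap.piMap fun _ : Fin 2 =>
    (QuotientAddGroup.isOpenQuotientMap_mk : IsOpenQuotientMap ((↑) : ℝ → UnitAddCircle))).comp
    (Homeomorph.piFinTwo fun _ => ℝ).symm.isOpenQuotientMap

theorem torusMk_eq_iff {q q' : ℝ × ℝ} : torusMk q = torusMk q' ↔ q' - q ∈ lattice := by
  have h : ∀ x y : ℝ, (x : UnitAddCircle) = (y : UnitAddCircle) ↔ ∃ n : ℤ, y - x = n := fun x y => by
    rw [eq_comm, ← sub_eq_zero, ← AddCircle.coe_sub, AddCircle.coe_eq_zero_iff]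
    simp [eq_comm]
  rw [funext_iff, Fin.forall_fin_two, mem_lattice]
  simp only [torusMk, h]
  constructor
  · rintro ⟨⟨a, ha⟩, ⟨b, hb⟩⟩
    exact ⟨a, b, Prod.ext ha hb⟩
  · rintro ⟨a, b, e⟩
    exact ⟨⟨a, congrArg Prod.fst e⟩, ⟨b, congrArg Prod.snd e⟩⟩

theorem torusMk_add_smul (q : ℝ × ℝ) (t : ℝ) (a b : ℕ) :
    torusMk (q + t • ((a : ℝ), (b : ℝ))) =
      torusMk q + fun i => (![a, b] i) • (t : UnitAddCircle) := by
  funext i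
  fin_cases i <;> simp [torusMk, mul_comm t]

namespace ContactBoundary

variable {m : ℕ} {C : PolarizedCycle m} (B : ContactBoundary C) [NeZero m]

/-- The linear loops in one class are the translates of one loop, so they form a torus. -/
theorem exists_torus_parametrization (j : ℤ) (a b : ℕ) (s : ℝ) :
    ∃ Ψ : C(UnitAddTorus (Fin 2), C(UnitAddCircle, C.Bdry × ℝ)),
      Function.Injective Ψ ∧ Set.range Ψ = B.linearLoops j ((a : ℝ), (b : ℝ)) s := by
  have hc : Continuous (fun q => C.chart j (q, s)) :=
    (C.continuous_chart j).comp (Continuous.prodMk_left s)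
  have hquot := isOpenQuotientMap_torusMk.isQuotientMap
  obtain ⟨fib, hfibc, hfib⟩ : ∃ fib : UnitAddTorus (Fin 2) → C.Bdry, Continuous fib ∧
      ∀ q, fib (torusMk q) = C.chart j (q, s) := by
    have hs := hquot.surjective
    have hf : ∀ q, C.chart j (Function.surjInv hs (torusMk q), s) = C.chart j (q, s) := fun q =>
      C.chart_eq_iff_sub_mem.2 (torusMk_eq_iff.1 (Function.surjInv_eq hs _))
    refine ⟨fun τ => C.chart j (Function.surjInv hs τ, s), hquot.continuous_iff.2 ?_, hf⟩
    exact hc.congr fun q => (hf q).symm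
  let G : C(UnitAddTorus (Fin 2) × UnitAddCircle, C.Bdry × ℝ) :=
    ⟨fun x => (fib (x.1 + fun i => (![a, b] i) • x.2), Real.log (B.A j s ((a : ℝ), (b : ℝ)))), by
      fun_prop⟩
  have hG : ∀ (q : ℝ × ℝ) (t : ℝ), G.curry (torusMk q) (t : UnitAddCircle) =
      (C.chart j (q + t • ((a : ℝ), (b : ℝ)), s), Real.log (B.A j s ((a : ℝ), (b : ℝ)))) :=
    fun q t => by
      rw [← hfib, torusMk_add_smul]; rfl
  refine ⟨G.curry, fun τ τ' h => ?_, ?_⟩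
  · obtain ⟨q, rfl⟩ := hquot.surjective τ
    obtain ⟨q', rfl⟩ := hquot.surjective τ'
    have h1 := congrArg (fun γ : C(UnitAddCircle, C.Bdry × ℝ) => (γ ((0 : ℝ) : UnitAddCircle)).1) h
    simp only [hG, zero_smul, add_zero] at h1
    exact torusMk_eq_iff.2 (C.chart_eq_iff_sub_mem.1 h1)
  · ext γ
    constructor
    · rintro ⟨τ, rfl⟩
      obtain ⟨q, rfl⟩ := hquot.surjective τ
      exact ⟨q, hG q⟩
    · rintro ⟨q, hq⟩
      refine ⟨torusMk q, ContinuousMap.ext fun t => ?_⟩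
      obtain ⟨r, rfl⟩ := QuotientAddGroup.mk_surjective t
      exact (hG q r).trans (hq r).symm

theorem linearLoops_nonempty (j : ℤ) (a b : ℕ) (s : ℝ) :
    (B.linearLoops j ((a : ℝ), (b : ℝ)) s).Nonempty := by
  obtain ⟨Ψ, -, h⟩ := B.exists_torus_parametrization j a b s
  rw [← h]
  exact Set.range_nonempty _

/-- A linear loop determines its base point and its homology class up to the deck
transformations. -/
theorem frame_eq_of_mem_linearLoops {j j' : ℤ} {v v' : ℝ × ℝ} {s s' : ℝ}
    {γ : C(UnitAddCircle, C.Bdry × ℝ)} (h : γ ∈ B.linearLoops j v s)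
    (h' : γ ∈ B.linearLoops j' v' s') :
    ∃ n : ℤ, s' = s + n * m ∧ C.frame j' v' = C.frame (j + n * m) v := by
  obtain ⟨q, hq⟩ := h
  obtain ⟨q', hq'⟩ := h'
  have h1 := fun t => C.chart_eq_iff.1 (congrArg Prod.fst ((hq t).symm.trans (hq' t)))
  obtain ⟨n, hn, -⟩ := h1 0
  refine ⟨n, hn, sub_eq_zero.1
    (eq_zero_of_line_mem_lattice (p := C.frame j' q' - C.frame (j + n * m) q) fun t => ?_)⟩
  obtain ⟨n', hn', h2⟩ := h1 t
  have hm : (m : ℝ) ≠ 0 := by exact_mod_cast NeZero.ne m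
  have e : n' = n := by
    have : (n' : ℝ) * m = n * m := by linarith
    exact_mod_cast mul_right_cancel₀ hm this
  rw [e, ← LinearEquiv.mul_apply, ← C.frame_add_int_mul_period] at h2
  simp only [map_add, map_smul] at h2
  convert h2 using 1
  module

end ContactBoundary

/-! ### The family of loops of an integral point -/

namespace PolarizedCycle

variable {m : ℕ} (C : PolarizedCycle m)

theorem tropPt_edge (i : ZMod m) (n : ℕ) : C.tropPt i n 0 = C.tropPt (i + 1) 0 n :=
  Quot.sound (EdgeRel.edge i n)

theorem tropPt_zero (i : ZMod m) : C.tropPt i 0 0 = C.tropZero := by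
  obtain ⟨j, rfl⟩ := ZMod.intCast_surjective i
  induction j with
  | zero => simp [tropZero]
  | succ j ih => rw [← ih, C.tropPt_edge (j : ℤ)]; push_cast; rfl
  | pred j ih =>
    rw [tropPt_edge, ← ih]; congr 1; push_cast; ring

end PolarizedCycle

namespace ContactBoundary

variable {m : ℕ} {C : PolarizedCycle m} (B : ContactBoundary C) [NeZero m]

/-- The linear loops in the class of the point `(a, b)` of the cone `Q_i`, over the base point
determined by this class; no loops if `(a, b) = (0, 0)`. -/
def coneLoops (x : ZMod m × ℕ × ℕ) : Set C(UnitAddCircle, C.Bdry × ℝ) :=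
  {γ | x.2 ≠ (0, 0) ∧ ∃ j : ℤ, (j : ZMod m) = x.1 ∧
    ∃ s ∈ Set.Icc (B.peak (j - 1)) (B.peak j),
      ((x.2.1 : ℝ), (x.2.2 : ℝ)) ∈ B.reebLine j s ∧
      γ ∈ B.linearLoops j ((x.2.1 : ℝ), (x.2.2 : ℝ)) s}

theorem coneLoops_eq {j : ℤ} {a b : ℕ} {s : ℝ} (hab : (a, b) ≠ (0, 0))
    (hs : s ∈ Set.Icc (B.peak (j - 1)) (B.peak j)) (hv : ((a : ℝ), (b : ℝ)) ∈ B.reebLine j s) :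
    B.coneLoops (j, a, b) = B.linearLoops j ((a : ℝ), (b : ℝ)) s := by
  ext γ
  constructor
  · rintro ⟨-, j', hj, s', hs', hv', hγ⟩
    obtain ⟨n, hn⟩ := (ZMod.intCast_eq_intCast_iff_dvd_sub j j' m).1 hj.symm
    obtain rfl : j' = j + n * m := by linarith
    have p1 := B.peak_add_int_mul_period (j - 1) n
    have p2 := B.peak_add_int_mul_period j n
    rw [show j - 1 + n * (m : ℤ) = j + n * m - 1 by ring] at p1
    rw [p1, p2] at hs'
    obtain ⟨r, rfl⟩ : ∃ r, s' = r + n * m := ⟨s' - n * m, by ring⟩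
    rw [B.reebLine_add_int_mul_period] at hv'
    rw [B.linearLoops_deck] at hγ
    have e : r = s := (B.existsUnique_base j hab).unique
      ⟨⟨by linarith [hs'.1], by linarith [hs'.2]⟩, hv'⟩ ⟨hs, hv⟩
    rwa [← e]
  · exact fun hγ => ⟨hab, j, rfl, s, hs, hv, hγ⟩

/-- The linear loops attached to an integral point of `U^trop`. -/
def tropLoops : C.Trop → Set C(UnitAddCircle, C.Bdry × ℝ) :=
  Quot.lift B.coneLoops (by
    rintro x y ⟨i, n⟩
    obtain ⟨j, rfl⟩ := ZMod.intCast_surjective i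
    rcases Nat.eq_zero_or_pos n with rfl | hn
    · simp [coneLoops]
    -- over the common edge, the base point is the peak of the normal circle in both cones
    have hP := (B.isPeak j).1
    have h1 : ((n : ℝ), ((0 : ℕ) : ℝ)) ∈ B.reebLine j (B.peak j) := by
      rw [mem_reebLine]
      have : deriv (B.coord j) (B.peak j) = 0 := hP
      simp [this]
    have hg : glue (C.k j) ((n : ℝ), ((0 : ℕ) : ℝ)) = (((0 : ℕ) : ℝ), (n : ℝ)) := by simp [glue]
    have h2 : (((0 : ℕ) : ℝ), (n : ℝ)) ∈ B.reebLine (j + 1) (B.peak j) := by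
      rw [← hg, glue_mem_reebLine]; exact h1
    have e1 := B.coneLoops_eq (j := j) (a := n) (b := 0) (by simp [hn.ne'])
      ⟨(B.peak_lt j).le, le_rfl⟩ h1
    have e2 := B.coneLoops_eq (j := j + 1) (a := 0) (b := n) (by simp [hn.ne'])
      ⟨by rw [add_sub_cancel_right], (B.strictMono_peak (lt_add_one j)).le⟩ h2
    push_cast at e2
    rw [e1, e2, ← B.linearLoops_glue]
    simp [glue])

theorem tropLoops_tropPt {j : ℤ} {a b : ℕ} {s : ℝ} (hab : (a, b) ≠ (0, 0))
    (hs : s ∈ Set.Icc (B.peak (j - 1)) (B.peak j)) (hv : ((a : ℝ), (b : ℝ)) ∈ B.reebLine j s) :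
    B.tropLoops (C.tropPt j a b) = B.linearLoops j ((a : ℝ), (b : ℝ)) s :=
  B.coneLoops_eq hab hs hv

theorem tropLoops_zero : B.tropLoops C.tropZero = ∅ := by
  change B.coneLoops (0, 0, 0) = ∅
  simp [coneLoops]

theorem exists_rep {p : C.Trop} (hp : p ≠ C.tropZero) : ∃ (j : ℤ) (a b : ℕ) (s : ℝ),
    p = C.tropPt j a b ∧ (a, b) ≠ (0, 0) ∧ s ∈ Set.Icc (B.peak (j - 1)) (B.peak j) ∧
      ((a : ℝ), (b : ℝ)) ∈ B.reebLine j s := by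
  obtain ⟨⟨i, a, b⟩, rfl⟩ := Quot.exists_rep p
  obtain ⟨j, rfl⟩ := ZMod.intCast_surjective i
  have hab : (a, b) ≠ (0, 0) := by
    rintro h
    rw [Prod.mk.injEq] at h
    obtain ⟨rfl, rfl⟩ := h
    exact hp (C.tropPt_zero j)
  obtain ⟨s, ⟨hs, hv⟩, -⟩ := B.existsUnique_base j hab
  exact ⟨j, a, b, s, rfl, hab, hs, hv⟩

theorem tropPt_ne_zero (B : ContactBoundary C) {j : ℤ} {a b : ℕ} (hab : (a, b) ≠ (0, 0)) :
    C.tropPt j a b ≠ C.tropZero := fun h => by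
  obtain ⟨s, ⟨hs, hv⟩, -⟩ := B.existsUnique_base j hab
  have h1 := B.linearLoops_nonempty j a b s
  rw [← B.tropLoops_tropPt hab hs hv, h, tropLoops_zero] at h1
  exact Set.not_nonempty_empty h1

/-- Two cones whose intervals share a base point `s` are equal or adjacent. In the second case `s`
is a peak, and the vectors over it lie on the common edge of the cones. -/
theorem tropPt_eq_of_frame_eq {i j : ℤ} {a b a' b' : ℕ} {s : ℝ} (hij : i ≤ j)
    (hs : s ∈ Set.Icc (B.peak (i - 1)) (B.peak i)) (hs' : s ∈ Set.Icc (B.peak (j - 1)) (B.peak j))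
    (hv : ((a : ℝ), (b : ℝ)) ∈ B.reebLine i s)
    (hf : C.frame j ((a' : ℝ), (b' : ℝ)) = C.frame i ((a : ℝ), (b : ℝ))) :
    C.tropPt i a b = C.tropPt j a' b' := by
  rcases hij.eq_or_lt with rfl | hlt
  · have h := (C.frame i).injective hf
    simp only [Prod.mk.injEq, Nat.cast_inj] at h
    rw [h.1, h.2]
  · have h1 : B.peak i ≤ B.peak (j - 1) := B.strictMono_peak.monotone (by omega)
    have h2 : B.peak (j - 1) = B.peak i := le_antisymm (hs'.1.trans hs.2) h1
    have h3 : s = B.peak i := le_antisymm hs.2 (h2 ▸ hs'.1)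
    obtain rfl : j = i + 1 := by have := B.strictMono_peak.injective h2; omega
    have hP : deriv (B.coord i) (B.peak i) = 0 := (B.isPeak i).1
    have hQ : deriv (B.coord (i - 1)) (B.peak i) < 0 := (B.isPeak i).prev_deriv_neg
    rw [mem_reebLine, h3, hP, mul_zero, zero_add] at hv
    have hb : b = 0 := Nat.cast_eq_zero.1 ((mul_eq_zero.1 hv).resolve_right hQ.ne)
    subst hb
    rw [← C.frame_succ_apply i] at hf
    have h := (C.frame (i + 1)).injective hf
    simp only [glue, Prod.mk.injEq, Nat.cast_zero, mul_zero, sub_zero, neg_zero, Nat.cast_inj,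
      Nat.cast_eq_zero] at h
    rw [h.1, h.2, C.tropPt_edge]
    push_cast
    rfl

theorem eq_of_mem_tropLoops {p p' : C.Trop} {γ : C(UnitAddCircle, C.Bdry × ℝ)}
    (h : γ ∈ B.tropLoops p) (h' : γ ∈ B.tropLoops p') : p = p' := by
  have hne : ∀ p, γ ∈ B.tropLoops p → p ≠ C.tropZero := by
    rintro _ h rfl
    rw [tropLoops_zero] at h
    exact h
  obtain ⟨j, a, b, s, rfl, hab, hs, hv⟩ := B.exists_rep (hne p h)
  obtain ⟨j', a', b', s', rfl, hab', hs', hv'⟩ := B.exists_rep (hne p' h')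
  rw [B.tropLoops_tropPt hab hs hv] at h
  rw [B.tropLoops_tropPt hab' hs' hv'] at h'
  obtain ⟨n, rfl, hf⟩ := B.frame_eq_of_mem_linearLoops h h'
  have e : C.tropPt j a b = C.tropPt (j + n * m : ℤ) a b := by simp
  have hsn : s + n * m ∈ Set.Icc (B.peak (j + n * m - 1)) (B.peak (j + n * m)) := by
    have p1 := B.peak_add_int_mul_period (j - 1) n
    rw [show j - 1 + n * (m : ℤ) = j + n * m - 1 by ring] at p1
    rw [p1, B.peak_add_int_mul_period]
    exact ⟨by linarith [hs.1], by linarith [hs.2]⟩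
  rw [e]
  rcases le_total (j + n * m) j' with hle | hle
  · exact B.tropPt_eq_of_frame_eq hle hsn hs' (by rwa [B.reebLine_add_int_mul_period]) hf
  · exact (B.tropPt_eq_of_frame_eq hle hs' hsn hv' hf.symm).symm

/-- Only finitely many of the tori of loops lie below a given level. -/
theorem finite_tropLoops_below (L : ℝ) :
    {p : C.Trop | ∃ γ ∈ B.tropLoops p, (γ 0).2 < L}.Finite := by
  obtain ⟨c, hc, hlow⟩ := B.exists_linear_lower_bound
  set K := ⌈Real.exp L / c⌉₊
  have hfin : (Set.univ ×ˢ (Set.Iic K ×ˢ Set.Iic K) : Set (ZMod m × ℕ × ℕ)).Finite :=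
    Set.finite_univ.prod ((Set.finite_Iic K).prod (Set.finite_Iic K))
  refine (hfin.image fun x => C.tropPt x.1 x.2.1 x.2.2).subset ?_
  rintro p ⟨γ, hγ, hL⟩
  have hp : p ≠ C.tropZero := by
    rintro rfl
    rw [tropLoops_zero] at hγ
    exact hγ
  obtain ⟨j, a, b, s, rfl, hab, hs, hv⟩ := B.exists_rep hp
  rw [B.tropLoops_tropPt hab hs hv] at hγ
  rw [B.value_of_linearLoops hγ, Real.log_lt_iff_lt_exp (B.A_pos_of_mem hab hs hv)] at hL
  have h1 := hlow j s a b hs (by positivity) hv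
  have h2 : (a + b : ℝ) ≤ Real.exp L / c := by
    rw [le_div_iff₀ hc]; linarith
  have h3 : ((a + b : ℕ) : ℝ) ≤ K := by push_cast; exact h2.trans (Nat.le_ceil _)
  have h4 : a + b ≤ K := by exact_mod_cast h3
  exact ⟨(j, a, b), ⟨trivial, show a ≤ K by omega, show b ≤ K by omega⟩, rfl⟩

theorem mem_orbits_iff_tropLoops {ρ₀ : ℝ} (hρ : ∀ T, B.IsReebPeriod T → Real.exp ρ₀ ≤ T)
    {γ : C(UnitAddCircle, C.Bdry × ℝ)} :
    γ ∈ B.orbits ρ₀ ↔ ∃ p : {p : C.Trop // p ≠ C.tropZero}, γ ∈ B.tropLoops p := by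
  rw [B.mem_orbits_iff hρ]
  constructor
  · rintro ⟨j, s, a, b, hab, hs, hv, hγ⟩
    exact ⟨⟨C.tropPt j a b, B.tropPt_ne_zero hab⟩, by rwa [B.tropLoops_tropPt hab hs hv]⟩
  · rintro ⟨⟨p, hp⟩, hγ⟩
    obtain ⟨j, a, b, s, rfl, hab, hs, hv⟩ := B.exists_rep hp
    exact ⟨j, s, a, b, hab, hs, hv, by rwa [B.tropLoops_tropPt hab hs hv] at hγ⟩

theorem exists_tropLoops_parametrization (p : {p : C.Trop // p ≠ C.tropZero}) :
    ∃ Ψ : C(UnitAddTorus (Fin 2), C(UnitAddCircle, C.Bdry × ℝ)),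
      Function.Injective Ψ ∧ Set.range Ψ = B.tropLoops p := by
  obtain ⟨j, a, b, s, hp, hab, hs, hv⟩ := B.exists_rep p.2
  rw [hp, B.tropLoops_tropPt hab hs hv]
  exact B.exists_torus_parametrization j a b s

/-- The space of orbits is the disjoint union of the tori: each torus is compact, and it is open in
the space of orbits, as only finitely many other tori come near to its level. -/
theorem exists_homeomorph {ρ₀ : ℝ} (hρ : ∀ T, B.IsReebPeriod T → Real.exp ρ₀ ≤ T) :
    ∃ Φ : (Σ _ : {p : C.Trop // p ≠ C.tropZero}, UnitAddTorus (Fin 2)) ≃ₜ B.orbits ρ₀,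
      ∀ p : {p : C.Trop // p ≠ C.tropZero},
        Set.range (fun τ => (Φ ⟨p, τ⟩ : C(UnitAddCircle, C.Bdry × ℝ))) = B.tropLoops p := by
  choose Ψ hinj hrange using B.exists_tropLoops_parametrization
  have hmem : ∀ p τ, Ψ p τ ∈ B.orbits ρ₀ := fun p τ =>
    (B.mem_orbits_iff_tropLoops hρ).2 ⟨p, hrange p ▸ Set.mem_range_self τ⟩
  let g : ∀ _ : {p : C.Trop // p ≠ C.tropZero}, UnitAddTorus (Fin 2) → B.orbits ρ₀ :=
    fun p τ => ⟨Ψ p τ, hmem p τ⟩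
  have hg : ∀ p, Continuous (g p) := fun p => (Ψ p).continuous.subtype_mk _
  have hginj : ∀ p, Function.Injective (g p) := fun p τ τ' h =>
    hinj p (congrArg Subtype.val h)
  have hgmem : ∀ p (γ : B.orbits ρ₀), γ ∈ Set.range (g p) ↔ γ.1 ∈ B.tropLoops p := fun p γ => by
    rw [← hrange p]
    constructor
    · rintro ⟨τ, rfl⟩; exact ⟨τ, rfl⟩
    · rintro ⟨τ, h⟩; exact ⟨τ, Subtype.ext h⟩
  have hopen : ∀ p, IsOpen (Set.range (g p)) := fun p => by
    obtain ⟨j, a, b, s, hp, hab, hs, hv⟩ := B.exists_rep p.2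
    set L := Real.log (B.A j s ((a : ℝ), (b : ℝ))) + 1 with hL
    have hfin : {p' : {p : C.Trop // p ≠ C.tropZero} |
        ∃ γ ∈ B.tropLoops p', (γ 0).2 < L}.Finite :=
      Set.Finite.preimage (f := Subtype.val) Subtype.val_injective.injOn
        (B.finite_tropLoops_below L)
    have hU : IsOpen {γ : B.orbits ρ₀ | (γ.1 0).2 < L} := by
      refine isOpen_lt ?_ continuous_const
      exact continuous_snd.comp ((continuous_eval_const 0).comp continuous_subtype_val)
    have hclosed : IsClosed (⋃ p' ∈ {p' : {p : C.Trop // p ≠ C.tropZero} |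
        ∃ γ ∈ B.tropLoops p', (γ 0).2 < L} \ {p}, Set.range (g p')) :=
      (hfin.subset Set.sdiff_subset).isClosed_biUnion fun p' _ =>
        (isCompact_range (hg p')).isClosed
    -- below the level `L`, the torus of `p` is the complement of the other tori
    convert hU.inter hclosed.isOpen_compl using 1
    ext γ
    simp only [hgmem, Set.mem_inter_iff, Set.mem_ofPred_eq, Set.mem_compl_iff, Set.mem_iUnion,
      not_exists]
    constructor
    · intro h
      refine ⟨?_, fun p' hp' h' => hp'.2 (Subtype.ext (B.eq_of_mem_tropLoops h' h))⟩
      rw [hp, B.tropLoops_tropPt hab hs hv] at h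
      rw [B.value_of_linearLoops h, hL]
      exact lt_add_one _
    · rintro ⟨h1, h2⟩
      obtain ⟨p', hp'⟩ := (B.mem_orbits_iff_tropLoops hρ).1 γ.2
      by_cases e : p' = p
      · rwa [← e]
      · exact absurd hp' (h2 p' ⟨⟨γ.1, hp', h1⟩, e⟩)
  let f : (Σ _ : {p : C.Trop // p ≠ C.tropZero}, UnitAddTorus (Fin 2)) → B.orbits ρ₀ :=
    fun x => g x.1 x.2
  have hf : Function.Bijective f := by
    constructor
    · rintro ⟨p, τ⟩ ⟨p', τ'⟩ h
      have h' : g p τ = g p' τ' := h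
      have hp : p = p' := Subtype.ext (B.eq_of_mem_tropLoops
        ((hgmem p _).1 ⟨τ, rfl⟩) ((hgmem p' _).1 ⟨τ', h'.symm⟩))
      subst hp
      rw [hginj p h']
    · intro γ
      obtain ⟨p, hp⟩ := (B.mem_orbits_iff_tropLoops hρ).1 γ.2
      obtain ⟨τ, hτ⟩ := (hgmem p γ).2 hp
      exact ⟨⟨p, τ⟩, hτ⟩
  have hfo : IsOpenMap f := isOpenMap_sigma.2 fun p =>
    (Topology.IsOpenEmbedding.mk ((hg p).isClosedEmbedding (hginj p)).isEmbedding
      (hopen p)).isOpenMap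
  exact ⟨(Equiv.ofBijective f hf).toHomeomorphOfContinuousOpen (continuous_sigma hg) hfo, hrange⟩

end ContactBoundary

end LogCY

theorem mainTheorem3 {m : ℕ} [NeZero m] (C : LogCY.PolarizedCycle m)
    (B : LogCY.ContactBoundary C) :
    ∃ t : ℤ → ℝ,
      -- the intervals `[t (j - 1), t j]` are the neighbourhoods of the nodes; they tile the base
      StrictMono t ∧ (∀ j : ℤ, t (j + m) = t j + m) ∧
      -- at `t j`, a point along `D_j`, the line is spanned by the normal circle to `D_j`
      (∀ j : ℤ, ((1, 0) : ℝ × ℝ) ∈ B.reebLine j (t j) ∧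
        ∀ s ∈ Set.uIcc (j : ℝ) (t j), 0 < B.A j s (1, 0)) ∧
      -- the node lies inside its neighbourhood if the line at the node meets the inside of `Q_j`
      (∀ j : ℤ, (∃ x y : ℝ, 0 < x ∧ 0 < y ∧ (x, y) ∈ B.reebLine j j) →
        t (j - 1) < j ∧ (j : ℝ) < t j) ∧
      -- each rational direction of the cone `Q_j` is passed exactly once, positively
      (∀ (j : ℤ) (a b : ℕ), (a, b) ≠ (0, 0) →
        (∃! s, s ∈ Set.Icc (t (j - 1)) (t j) ∧ ((a : ℝ), (b : ℝ)) ∈ B.reebLine j s) ∧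
        ∀ s ∈ Set.Icc (t (j - 1)) (t j), ((a : ℝ), (b : ℝ)) ∈ B.reebLine j s →
          0 < B.A j s ((a : ℝ), (b : ℝ))) ∧
      -- the periods of the closed Reeb orbits are bounded below by a positive number
      (∃ ρ₀ : ℝ, ∀ T, B.IsReebPeriod T → Real.exp ρ₀ ≤ T) ∧
      -- the orbits in the end form a disjoint union of tori, one for each nonzero integral point
      ∀ ρ₀ : ℝ, (∀ T, B.IsReebPeriod T → Real.exp ρ₀ ≤ T) →
        ∃ Φ : (Σ _ : {p : C.Trop // p ≠ C.tropZero}, UnitAddTorus (Fin 2)) ≃ₜ B.orbits ρ₀,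
          ∀ (p : {p : C.Trop // p ≠ C.tropZero}) (j : ℤ) (a b : ℕ), C.tropPt j a b = p →
            ∀ s ∈ Set.Icc (t (j - 1)) (t j), ((a : ℝ), (b : ℝ)) ∈ B.reebLine j s →
              Set.range (fun τ => (Φ ⟨p, τ⟩ : C(UnitAddCircle, C.Bdry × ℝ))) =
                B.linearLoops j ((a : ℝ), (b : ℝ)) s := by
  refine ⟨B.peak, B.strictMono_peak, B.peak_add_period, fun j => ⟨?_, fun s hs => ?_⟩, ?_,
    fun j a b hab => ⟨B.existsUnique_base j hab, fun s hs hv => B.A_pos_of_mem hab hs hv⟩,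
    B.exists_period_bound, fun ρ₀ hρ => ?_⟩
  · have h : deriv (B.coord j) (B.peak j) = 0 := (B.isPeak j).1
    simp [B.mem_reebLine, h]
  · have h : 0 < B.coord j s := (B.isPeak j).2 s hs
    simpa [B.A_apply] using h
  · rintro j ⟨x, y, hx, hy, h⟩
    exact (B.isPeak (j - 1)).mem_Ioo (B.isPeak j) hx hy (B.mem_reebLine.1 h)
  · obtain ⟨Φ, hΦ⟩ := B.exists_homeomorph hρ
    refine ⟨Φ, fun p j a b hp s hs hv => ?_⟩
    have hab : (a, b) ≠ (0, 0) := by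
      intro h
      rw [Prod.mk.injEq] at h
      rw [h.1, h.2] at hp
      exact p.2 (hp.symm.trans (C.tropPt_zero j))
    rw [hΦ, ← hp, B.tropLoops_tropPt hab hs hv]
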